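/- **Conventions.** Let $H$ be a commutative (multiplicative) monoid with more than one element. Let $z(H)=\{z\in H : zx=z \text{ for all } x\in H\}$ (a set with at most one element, empty if $H$ has no zero). Assume that every element of $H\setminus z(H)$ is cancellative, and let $G\supseteq H$ be the quotient monoid of $H$, i.e. the localization of $H$ at $H\setminus z(H)$. For $X\subseteq H$ let $\sqrt X=\{x\in H : x^n\in X\text{ for some integer } n\ge 1\}$, and call $X$ *radical* if $\sqrt X=X$. For $Y\subseteq G$ let $Y^{-1}=\{z\in G : zY\subseteq H\}$. An *$s$-ideal* is a set $X\subseteq H$ with $X=XH\cup z(H)$. A *principal ideal* is a set $AH\cup z(H)$ with $A\subseteq H$, $|A|\le 1$; it is *nontrivial* if it properly contains $z(H)$. A *prime $s$-ideal* is an $s$-ideal $P\ne H$ such that $xy\in P$ implies $x\in P$ or $y\in P$; then $H_P=(H\setminus P)^{-1}H$. If $H\neq G$, let $X_v=(X^{-1})^{-1}$ for $X\subseteq H$. If $H=G$, let $X_v=z(H)$ for $X\subseteq z(H)$ and $X_v=H$ for all other $X\subseteq H$. Let $X_t=\bigcup_{E\subseteq X,\ |E|<\infty}E_v$. A *$t$-ideal*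 is a set $X\subseteq H$ with $X_t=X$. It is *$t$-finitely generated* if $X=E_t$ for some finite $E\subseteq X$, and *$t$-invertible* if $(XX^{-1})_t=H$. The *$t$-product* of $t$-ideals $I_1,\dots,I_n$ is $(I_1\cdots I_n)_t$. A *$t$-maximal* $t$-ideal is a maximal element of the set of $t$-ideals different from $H$ (such a $t$-ideal is always a prime $s$-ideal). A monoid as above is a *discrete valuation monoid* if it is different from its quotient monoid and all its $s$-ideals are principal. $H$ is * *$t$-almost Dedekind* if $H=G$, or $H_M$ is a discrete valuation monoid for every $t$-maximal $t$-ideal $M$ of $H$; * a *$t$-SP-monoid* if every $t$-ideal of $H$ is a $t$-product of finitely many radical $t$-ideals of $H$; * a *$t$-finite conductor monoid* if $xH\cap yH$ is $t$-finitely generated for all $x,y\in H$. **Theorem 4.2.** The following are equivalent: 1. $H$ is a $t$-almost Dedekind $t$-SP-monoid. 2. $H$ is a $t$-finite conductor monoid and every principal ideal of $H$ is a $t$-product of finitely many radical $t$-ideals of $H$. 3. Every $t$-ideal of $H$ is a $t$-product of finitely many pairwise comparable (with respect to inclusion) radical $t$-ideals of $H$. 4. The radical of every nontrivial principal ideal of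 $H$ is a $t$-invertible $t$-ideal of $H$. -/

import Mathlib

open scoped Pointwise

namespace IdealSystem

/-- The set `z(H)` of zero elements of a commutative monoid; it has at most one element, and it is
empty if `H` has no zero. -/
def zeroElems (H : Type*) [CommMonoid H] : Set H := {z | ∀ x : H, z * x = z}

/-- The standing convention on monoids: a commutative semigroup with identity and more than one
element in which every nonzero element is cancellative. A zero element may or may not exist. -/
class CancellativeOffZero (H : Type*) [CommMonoid H] : Prop extends Nontrivial H where
  cancel : ∀ a : H, a ∉ zeroElems H → ∀ b c : H, a * b = a * c → b = c

theorem zeroElems_unique {H : Type*} [CommMonoid H] {y z : H} (hy : y ∈ zeroElems H)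
    (hz : z ∈ zeroElems H) : y = z := by
  rw [← hy z, mul_comm, hz y]

theorem one_notMem_zeroElems {H : Type*} [CommMonoid H] [Nontrivial H] :
    (1 : H) ∉ zeroElems H := by
  intro h
  obtain ⟨x, hx⟩ := exists_ne (1 : H)
  exact hx (by simpa using h x)

theorem mul_mem_zeroElems {H : Type*} [CommMonoid H] {z : H} (hz : z ∈ zeroElems H) (x : H) :
    z * x ∈ zeroElems H := by
  rw [hz x]
  exact hz

theorem mul_notMem_zeroElems {H : Type*} [CommMonoid H] [CancellativeOffZero H] {a b : H}
    (ha : a ∉ zeroElems H) (hb : b ∉ zeroElems H) : a * b ∉ zeroElems H := by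
  intro h
  refine hb fun x => CancellativeOffZero.cancel a ha _ _ ?_
  rw [← mul_assoc, h x]

/-- The multiplicative monoid of the nonzero elements of `H`. -/
def nonzeros (H : Type*) [CommMonoid H] [CancellativeOffZero H] : Submonoid H where
  carrier := {x | x ∉ zeroElems H}
  one_mem' := one_notMem_zeroElems
  mul_mem' := mul_notMem_zeroElems

/-- The quotient monoid `G` of `H`: the localization at all nonzero elements. -/
abbrev QuotientMonoid (H : Type*) [CommMonoid H] [CancellativeOffZero H] : Type _ :=
  Localization (nonzeros H)

/-- The canonical (injective) map from `H` to its quotient monoid `G`. -/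
def toQuotient {H : Type*} [CommMonoid H] [CancellativeOffZero H] (x : H) : QuotientMonoid H :=
  Localization.mk x 1

/-- `H = G`. -/
def EqQuotient (H : Type*) [CommMonoid H] [CancellativeOffZero H] : Prop :=
  Function.Surjective (toQuotient : H → QuotientMonoid H)

/-- `Y⁻¹ = {z ∈ G | zY ⊆ H}` for a subset `Y` of `G`. -/
def inverse {H : Type*} [CommMonoid H] [CancellativeOffZero H] (Y : Set (QuotientMonoid H)) :
    Set (QuotientMonoid H) :=
  {z | ∀ y ∈ Y, z * y ∈ Set.range (toQuotient : H → QuotientMonoid H)}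

/-- The radical of a subset of `H`. -/
def radical {H : Type*} [CommMonoid H] (X : Set H) : Set H := {x | ∃ n : ℕ, 0 < n ∧ x ^ n ∈ X}

/-- A subset is radical if it equals its radical. -/
def IsRadical {H : Type*} [CommMonoid H] (X : Set H) : Prop := radical X = X

/-- `X` is an `s`-ideal if `X = XH ∪ z(H)`. -/
def IsSIdeal {H : Type*} [CommMonoid H] (X : Set H) : Prop :=
  X = X * (Set.univ : Set H) ∪ zeroElems H

/-- Principal ideals are the sets `AH ∪ z(H)` where `A` has at most one element. -/
def IsPrincipal {H : Type*} [CommMonoid H] (J : Set H) : Prop :=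
  ∃ A : Set H, A.Subsingleton ∧ J = A * (Set.univ : Set H) ∪ zeroElems H

/-- Prime `s`-ideals. -/
structure IsPrimeSIdeal {H : Type*} [CommMonoid H] (P : Set H) : Prop where
  isSIdeal : IsSIdeal P
  ne_univ : P ≠ Set.univ
  mem_or_mem : ∀ x y : H, x * y ∈ P → x ∈ P ∨ y ∈ P

/-- The `v`-system: `X ↦ (X⁻¹)⁻¹` if `H ≠ G`; if `H = G`, it sends the subsets of `z(H)` to `z(H)`
and all other sets to `H`. (The set `(X⁻¹)⁻¹` lies in `H` because `1 ∈ X⁻¹`.) -/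
noncomputable def vClosure {H : Type*} [CommMonoid H] [CancellativeOffZero H] (X : Set H) :
    Set H :=
  open Classical in
  if EqQuotient H then (if X ⊆ zeroElems H then zeroElems H else Set.univ)
  else toQuotient ⁻¹' inverse (inverse (toQuotient '' X))

/-- The `t`-system: `X_t` is the union of the sets `E_v`, for the finite subsets `E` of `X`. -/
noncomputable def tClosure {H : Type*} [CommMonoid H] [CancellativeOffZero H] (X : Set H) :
    Set H :=
  ⋃ E ∈ {E : Set H | E ⊆ X ∧ E.Finite}, vClosure E

/-! In the following definitions `r` stands for the closure `X ↦ X_r` of an ideal system. -/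

/-- `X` is an `r`-ideal. -/
def IsRIdeal {H : Type*} (r : Set H → Set H) (X : Set H) : Prop := r X = X

/-- `X` is an `r`-invertible `r`-ideal: `X_r = X` and `(X X⁻¹)_r = H`. (The product `X X⁻¹` is a
subset of `H`.) -/
def IsRInvertible {H : Type*} [CommMonoid H] [CancellativeOffZero H] (r : Set H → Set H)
    (X : Set H) : Prop :=
  IsRIdeal r X ∧
    r (toQuotient ⁻¹' (toQuotient '' X * inverse (toQuotient '' X))) = Set.univ

/-- `I` is an `r`-finitely generated `r`-ideal. -/
def IsRFinitelyGenerated {H : Type*} (r : Set H → Set H) (I : Set H) : Prop :=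
  ∃ E : Set H, E.Finite ∧ E ⊆ I ∧ I = r E

/-- `M` is an `r`-maximal `r`-ideal: maximal among the proper `r`-ideals. -/
def IsRMaximal {H : Type*} (r : Set H → Set H) (M : Set H) : Prop :=
  Maximal (fun I : Set H => IsRIdeal r I ∧ I ≠ Set.univ) M

/-- `I` is a finite `r`-product of radical `r`-ideals. -/
def IsFiniteProductOfRadicals {H : Type*} [CommMonoid H] (r : Set H → Set H) (I : Set H) : Prop :=
  ∃ (n : ℕ) (J : Fin n → Set H), (∀ i, IsRIdeal r (J i) ∧ IsRadical (J i)) ∧ I = r (∏ i, J i)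

/-- `I` is an `r`-product of finitely many pairwise comparable radical `r`-ideals. -/
def IsFiniteProductOfComparableRadicals {H : Type*} [CommMonoid H] (r : Set H → Set H)
    (I : Set H) : Prop :=
  ∃ (n : ℕ) (J : Fin n → Set H), (∀ i, IsRIdeal r (J i) ∧ IsRadical (J i)) ∧
    (∀ i j, J i ⊆ J j ∨ J j ⊆ J i) ∧ I = r (∏ i, J i)

/-- `r`-SP-monoids. -/
def IsSPMonoid {H : Type*} [CommMonoid H] (r : Set H → Set H) : Prop :=
  ∀ I : Set H, IsRIdeal r I → IsFiniteProductOfRadicals r I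

/-- `r`-finite conductor monoids. -/
def IsFiniteConductor {H : Type*} [CommMonoid H] (r : Set H → Set H) : Prop :=
  ∀ x y : H, IsRFinitelyGenerated r (({x} * (Set.univ : Set H)) ∩ ({y} * (Set.univ : Set H)))

/-- Discrete valuation monoids: `H ≠ G` and every `s`-ideal is principal. -/
def IsDVM (H : Type*) [CommMonoid H] [CancellativeOffZero H] : Prop :=
  ¬ EqQuotient H ∧ ∀ X : Set H, IsSIdeal X → IsPrincipal X

/-- The complement of a prime `s`-ideal. -/
def primeCompl {H : Type*} [CommMonoid H] (P : Set H) (hP : IsPrimeSIdeal P) : Submonoid H where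
  carrier := Pᶜ
  one_mem' := by
    intro h
    refine hP.ne_univ (Set.eq_univ_of_forall fun x => ?_)
    rw [hP.isSIdeal]
    exact Or.inl ⟨1, h, x, Set.mem_univ x, one_mul x⟩
  mul_mem' := by
    intro a b ha hb h
    exact (hP.mem_or_mem a b h).elim ha hb

theorem primeCompl_le {H : Type*} [CommMonoid H] [CancellativeOffZero H] (P : Set H)
    (hP : IsPrimeSIdeal P) : primeCompl P hP ≤ nonzeros H := by
  intro x hx hz
  apply hx
  rw [hP.isSIdeal]
  exact Or.inr hz

/-- The localization `H_P = (H \ P)⁻¹H` at a prime `s`-ideal `P`. -/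
abbrev LocalizationAt {H : Type*} [CommMonoid H] (P : Set H) (hP : IsPrimeSIdeal P) : Type _ :=
  Localization (primeCompl P hP)

theorem cancellativeOffZero_localization {H : Type*} [CommMonoid H] [CancellativeOffZero H]
    (T : Submonoid H) (hT : T ≤ nonzeros H) : CancellativeOffZero (Localization T) := by
  have key : ∀ (a b : H) (s u : T),
      (Localization.mk a s = Localization.mk b u ↔ (u : H) * a = s * b) := by
    intro a b s u
    rw [Localization.mk_eq_mk_iff, Localization.r_iff_exists]
    constructor
    · rintro ⟨c, hc⟩
      exact CancellativeOffZero.cancel _ (hT c.2) _ _ hc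
    · intro h
      exact ⟨1, by rw [h]⟩
  refine @CancellativeOffZero.mk _ _ ?_ ?_
  · obtain ⟨x, y, hxy⟩ := exists_pair_ne H
    refine ⟨Localization.mk x 1, Localization.mk y 1, fun h => hxy ?_⟩
    simpa using (key _ _ _ _).1 h
  · intro p hp q r
    induction p using Localization.induction_on with | _ p
    induction q using Localization.induction_on with | _ q
    induction r using Localization.induction_on with | _ r
    obtain ⟨a, s⟩ := p
    obtain ⟨b, u⟩ := q
    obtain ⟨c, w⟩ := r
    have ha : a ∉ zeroElems H := by
      intro ha
      refine hp fun x => ?_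
      induction x using Localization.induction_on with | _ x
      rw [Localization.mk_mul, key, ha x.1, mul_comm _ a, mul_comm _ a, ha, ha]
    intro h
    rw [Localization.mk_mul, Localization.mk_mul, key] at h
    rw [key]
    refine CancellativeOffZero.cancel _ (mul_notMem_zeroElems (hT s.2) ha) _ _ ?_
    simp only [Submonoid.coe_mul] at h
    calc (s : H) * a * (w * b) = s * w * (a * b) := by ac_rfl
      _ = s * u * (a * c) := h
      _ = s * a * (u * c) := by ac_rfl

instance {H : Type*} [CommMonoid H] [CancellativeOffZero H] (P : Set H) (hP : IsPrimeSIdeal P) :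
    CancellativeOffZero (LocalizationAt P hP) :=
  cancellativeOffZero_localization _ (primeCompl_le P hP)

/-- `r`-almost Dedekind monoids: `H = G`, or `H_M` is a discrete valuation monoid for every
`r`-maximal `r`-ideal `M`. (For finitary ideal systems, such as the `t`-system, the `r`-maximal
`r`-ideals are automatically prime, so that `H_M` makes sense.) -/
def IsAlmostDedekind {H : Type*} [CommMonoid H] [CancellativeOffZero H] (r : Set H → Set H) :
    Prop :=
  EqQuotient H ∨
    ∀ M : Set H, IsRMaximal r M → ∃ hM : IsPrimeSIdeal M, IsDVM (LocalizationAt M hM)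

end IdealSystem

open scoped Pointwise

set_option linter.unusedSectionVars false

namespace IdealSystem

/-! ### Divisibility, fractions and principal ideals. -/

section Basic

variable {H : Type*} [CommMonoid H] [CancellativeOffZero H]

/-! If H = G, the only t-ideals are z(H) and H, and all four conditions hold. Otherwise everything
is tested at the t-maximal ideals M: a t-ideal contains x as soon as, for each M, it contains sx for
some s ∉ M (`IsRIdeal.mem_of_forall_maximal`).

Condition 4 is the hub. If radicals of nontrivial principal ideals are t-invertible, then I = √(xH)
and K I⁻¹ with K = √(xzH) are t-coprime (`one_mem_tClosure_union`). This forces √(xH) ⊆ √(zH)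
locally at every M containing x, so √(xH) agrees locally with M, its local generator is a
uniformizer (`exists_isUniformizer`), and H_M carries a discrete valuation v_M. A t-ideal I ≠ z(H)
is then the t-product of the chain J_k = ⋂ {M : v_M ≥ k + 1 on I}. The chain may be cut off at a
finite stage because v_M(x) is bounded over all M (`exists_bound`), and J_k is locally trivial where
I has smaller value (`exists_notMem_of_lt`). This gives 3 and 1.

For 3 → 4, the smallest factor of xH is its radical, and factors of a nontrivial principal ideal are
t-invertible. For 1 → 2, divisibility is total at each M, so xH ∩ yH is locally principal, hence
t-invertible and t-finitely generated.

For 2 → 4, factoring principal ideals makes H completely integrally closed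
(`mem_integers_of_pow_mul_mem`). Together with the finite conductor property this makes divisibility
total at each M (`exists_locally_dvd_or_dvd`). A radical factor of xH lying in M is then generated
locally by a uniformizer and agrees locally with √(xH). -/

theorem mul_mem_zeroElems_left {z : H} (hz : z ∈ zeroElems H) (x : H) : x * z ∈ zeroElems H := by
  rw [mul_comm]
  exact mul_mem_zeroElems hz x

theorem dvd_of_mem_zeroElems {z : H} (hz : z ∈ zeroElems H) (x : H) : x ∣ z :=
  ⟨z, by rw [mul_comm, hz x]⟩

theorem notMem_zeroElems_of_dvd {a b : H} (hb : b ∉ zeroElems H) (h : a ∣ b) :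
    a ∉ zeroElems H := by
  obtain ⟨c, rfl⟩ := h
  exact fun ha => hb (mul_mem_zeroElems ha c)

theorem pow_notMem_zeroElems {a : H} (ha : a ∉ zeroElems H) (n : ℕ) : a ^ n ∉ zeroElems H :=
  (nonzeros H).pow_mem ha n

theorem cancel_left {a b c : H} (ha : a ∉ zeroElems H) (h : a * b = a * c) : b = c :=
  CancellativeOffZero.cancel a ha b c h

theorem dvd_of_mul_dvd_mul_left_of_notMem {a b c : H} (ha : a ∉ zeroElems H)
    (h : a * b ∣ a * c) : b ∣ c := by
  obtain ⟨d, hd⟩ := h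
  exact ⟨d, cancel_left ha (by rw [hd, mul_assoc])⟩

theorem toQuotient_one : toQuotient (1 : H) = 1 := Localization.mk_one

theorem toQuotient_mul (a b : H) : toQuotient (a * b) = toQuotient a * toQuotient b := by
  simp [toQuotient, Localization.mk_mul]

theorem toQuotient_pow (a : H) (n : ℕ) : toQuotient (a ^ n) = toQuotient a ^ n := by
  induction n with
  | zero => simp [toQuotient_one]
  | succ n ih => rw [pow_succ, pow_succ, toQuotient_mul, ih]

theorem toQuotient_injective : Function.Injective (toQuotient : H → QuotientMonoid H) := by
  intro a b h
  rw [toQuotient, toQuotient, Localization.mk_eq_mk_iff, Localization.r_iff_exists] at h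
  obtain ⟨c, hc⟩ := h
  simpa using cancel_left c.2 hc

theorem exists_mul_toQuotient_eq (z : QuotientMonoid H) :
    ∃ a b : H, b ∉ zeroElems H ∧ z * toQuotient b = toQuotient a := by
  induction z using Localization.induction_on with | _ y
  obtain ⟨a, b⟩ := y
  refine ⟨a, b, b.2, ?_⟩
  rw [toQuotient, toQuotient, Localization.mk_mul, Localization.mk_eq_mk_iff,
    Localization.r_iff_exists]
  exact ⟨1, by simp [mul_comm]⟩

theorem exists_inverse_toQuotient {b : H} (hb : b ∉ zeroElems H) :
    ∃ z : QuotientMonoid H, z * toQuotient b = 1 := by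
  refine ⟨Localization.mk 1 ⟨b, hb⟩, ?_⟩
  rw [toQuotient, Localization.mk_mul]
  simpa using Localization.mk_self (⟨b, hb⟩ : nonzeros H)

theorem mul_toQuotient_cancel {b : H} (hb : b ∉ zeroElems H) {y z : QuotientMonoid H}
    (h : y * toQuotient b = z * toQuotient b) : y = z := by
  obtain ⟨w, hw⟩ := exists_inverse_toQuotient hb
  calc y = y * toQuotient b * w := by rw [mul_assoc, mul_comm _ w, hw, mul_one]
    _ = z * toQuotient b * w := by rw [h]
    _ = z := by rw [mul_assoc, mul_comm _ w, hw, mul_one]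

theorem exists_fraction (a : H) {b : H} (hb : b ∉ zeroElems H) :
    ∃ z : QuotientMonoid H, z * toQuotient b = toQuotient a := by
  obtain ⟨z, hz⟩ := exists_inverse_toQuotient hb
  exact ⟨toQuotient a * z, by rw [mul_assoc, hz, mul_one]⟩

variable (H) in
/-- The image of `H` in its quotient monoid. -/
def integers : Submonoid (QuotientMonoid H) where
  carrier := Set.range toQuotient
  one_mem' := ⟨1, toQuotient_one⟩
  mul_mem' := by
    rintro _ _ ⟨a, rfl⟩ ⟨b, rfl⟩
    exact ⟨a * b, toQuotient_mul a b⟩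

theorem toQuotient_mem_integers (a : H) : toQuotient a ∈ integers H := ⟨a, rfl⟩

theorem mul_toQuotient_mem_integers_iff {z : QuotientMonoid H} {a b : H}
    (hb : b ∉ zeroElems H) (hz : z * toQuotient b = toQuotient a) (x : H) :
    z * toQuotient x ∈ integers H ↔ b ∣ a * x := by
  constructor
  · rintro ⟨c, hc⟩
    refine ⟨c, toQuotient_injective ?_⟩
    rw [toQuotient_mul, toQuotient_mul, ← hz, hc]
    ac_rfl
  · rintro ⟨c, hc⟩
    refine ⟨c, mul_toQuotient_cancel hb ?_⟩
    rw [← toQuotient_mul, mul_comm c, ← hc, toQuotient_mul, ← hz]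
    ac_rfl

theorem mem_inverse_image {I : Set H} {z : QuotientMonoid H} :
    z ∈ inverse (toQuotient '' I) ↔ ∀ y ∈ I, z * toQuotient y ∈ integers H :=
  Set.forall_mem_image

theorem eqQuotient_iff : EqQuotient H ↔ ∀ x : H, x ∉ zeroElems H → IsUnit x := by
  constructor
  · intro h x hx
    obtain ⟨z, hz⟩ := exists_inverse_toQuotient hx
    obtain ⟨y, rfl⟩ := h z
    rw [← toQuotient_mul, ← toQuotient_one] at hz
    exact IsUnit.of_mul_eq_one y (by rw [mul_comm]; exact toQuotient_injective hz)
  · intro h z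
    obtain ⟨a, b, hb, hz⟩ := exists_mul_toQuotient_eq z
    obtain ⟨c, hc⟩ := (h b hb).dvd (a := a)
    exact ⟨c, mul_toQuotient_cancel hb (by rw [hz, ← toQuotient_mul, hc, mul_comm])⟩

theorem mem_tClosure {X : Set H} {x : H} :
    x ∈ tClosure X ↔ ∃ E ⊆ X, E.Finite ∧ x ∈ vClosure E := by
  simp [tClosure, and_assoc]

theorem isPrincipal_dvd (c : H) : IsPrincipal {x : H | c ∣ x} := by
  refine ⟨{c}, Set.subsingleton_singleton, ?_⟩
  ext x
  simp only [Set.mem_ofPred_eq, Set.singleton_mul, Set.image_univ, Set.mem_union, Set.mem_range]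
  constructor
  · rintro ⟨d, rfl⟩
    exact Or.inl ⟨d, rfl⟩
  · rintro (⟨d, rfl⟩ | h)
    · exact dvd_mul_right _ _
    · exact dvd_of_mem_zeroElems h c

theorem IsPrincipal.eq_or {I : Set H} (hI : IsPrincipal I) :
    I = zeroElems H ∨ ∃ c, I = {x : H | c ∣ x} := by
  obtain ⟨A, hA, rfl⟩ := hI
  obtain rfl | ⟨c, rfl⟩ := hA.eq_empty_or_singleton
  · simp
  · right
    refine ⟨c, ?_⟩
    ext x
    simp only [Set.mem_ofPred_eq, Set.singleton_mul, Set.image_univ, Set.mem_union, Set.mem_range]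
    constructor
    · rintro (⟨d, rfl⟩ | h)
      · exact dvd_mul_right _ _
      · exact dvd_of_mem_zeroElems h c
    · rintro ⟨d, rfl⟩
      exact Or.inl ⟨d, rfl⟩

theorem setOf_dvd_of_mem_zeroElems {c : H} (hc : c ∈ zeroElems H) :
    {x : H | c ∣ x} = zeroElems H := by
  ext x
  exact ⟨fun ⟨d, hd⟩ => hd ▸ mul_mem_zeroElems hc d,
    fun hx => dvd_of_mem_zeroElems hx c⟩

theorem isRadical_iff {X : Set H} : IsRadical X ↔ ∀ x : H, ∀ n : ℕ, 0 < n → x ^ n ∈ X → x ∈ X := by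
  constructor
  · intro h x n hn hx
    rw [← show radical X = X from h]
    exact ⟨n, hn, hx⟩
  · intro h
    refine Set.Subset.antisymm ?_ fun x hx => ⟨1, one_pos, by simpa using hx⟩
    rintro x ⟨n, hn, hx⟩
    exact h x n hn hx

theorem subset_radical (X : Set H) : X ⊆ radical X :=
  fun x hx => ⟨1, one_pos, by simpa using hx⟩

theorem isRadical_zeroElems : IsRadical (zeroElems H) := by
  rw [isRadical_iff]
  intro x n _ hx
  by_contra h
  exact pow_notMem_zeroElems h n hx

theorem isRadical_radical (X : Set H) : IsRadical (radical X) := by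
  rw [isRadical_iff]
  rintro x n hn ⟨m, hm, hx⟩
  exact ⟨n * m, Nat.mul_pos hn hm, by rwa [pow_mul]⟩

end Basic

/-! ### Prime s-ideals and their complements. -/

section PrimeSIdeal

variable {H : Type*} [CommMonoid H] {P : Set H}

theorem IsPrimeSIdeal.mul_mem_left (hP : IsPrimeSIdeal P) {x : H} (hx : x ∈ P) (y : H) :
    y * x ∈ P := by
  rw [hP.isSIdeal]
  exact Or.inl ⟨x, hx, y, Set.mem_univ y, mul_comm x y⟩

theorem IsPrimeSIdeal.mem_of_dvd (hP : IsPrimeSIdeal P) {x y : H} (hx : x ∈ P) (h : x ∣ y) :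
    y ∈ P := by
  obtain ⟨c, rfl⟩ := h
  rw [mul_comm]
  exact hP.mul_mem_left hx c

theorem IsPrimeSIdeal.mem_of_mem_zeroElems (hP : IsPrimeSIdeal P) {x : H}
    (hx : x ∈ zeroElems H) : x ∈ P := by
  rw [hP.isSIdeal]
  exact Or.inr hx

theorem IsPrimeSIdeal.one_notMem (hP : IsPrimeSIdeal P) : (1 : H) ∉ P :=
  (primeCompl P hP).one_mem

theorem IsPrimeSIdeal.mul_notMem (hP : IsPrimeSIdeal P) {x y : H} (hx : x ∉ P) (hy : y ∉ P) :
    x * y ∉ P :=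
  (primeCompl P hP).mul_mem hx hy

theorem IsPrimeSIdeal.pow_notMem (hP : IsPrimeSIdeal P) {x : H} (hx : x ∉ P) (n : ℕ) :
    x ^ n ∉ P :=
  (primeCompl P hP).pow_mem hx n

theorem IsPrimeSIdeal.notMem_zeroElems (hP : IsPrimeSIdeal P) {x : H} (hx : x ∉ P) :
    x ∉ zeroElems H :=
  fun h => hx (hP.mem_of_mem_zeroElems h)

/-- A finite subset whose members are individually carried into an ideal by elements outside a
prime is carried there by a single such element. -/
theorem IsPrimeSIdeal.exists_uniform_multiplier (hP : IsPrimeSIdeal P) {X E : Set H}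
    (hX : ∀ x ∈ X, ∀ y : H, y * x ∈ X) (hE : E.Finite) (h : ∀ e ∈ E, ∃ s ∉ P, s * e ∈ X) :
    ∃ s ∉ P, ∀ e ∈ E, s * e ∈ X := by
  induction E, hE using Set.Finite.induction_on with
  | empty => exact ⟨1, hP.one_notMem, by simp⟩
  | @insert a E ha hE ih =>
    obtain ⟨s, hs, h1⟩ := ih fun e he => h e (Set.mem_insert_of_mem a he)
    obtain ⟨t, ht, h2⟩ := h a (Set.mem_insert a E)
    refine ⟨s * t, hP.mul_notMem hs ht, ?_⟩
    rintro e (rfl | he)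
    · rw [mul_assoc]
      exact hX _ h2 s
    · rw [mul_comm s, mul_assoc]
      exact hX _ (h1 e he) t

end PrimeSIdeal

/-! ### The t-system when H ≠ G, and the local-global principle. -/

section TClosure

variable {H : Type*} [CommMonoid H] [CancellativeOffZero H] [hG : Fact (¬ EqQuotient H)]

theorem mem_vClosure {E : Set H} {x : H} :
    x ∈ vClosure E ↔ ∀ z : QuotientMonoid H, (∀ y ∈ E, z * toQuotient y ∈ integers H) →
      z * toQuotient x ∈ integers H := by
  rw [vClosure, if_neg hG.out]
  change (∀ z ∈ inverse (toQuotient '' E), toQuotient x * z ∈ integers H) ↔ _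
  simp only [mem_inverse_image, mul_comm (toQuotient x)]

theorem mem_vClosure_of_mem {E : Set H} {x : H} (hx : x ∈ E) : x ∈ vClosure E :=
  mem_vClosure.2 fun _ hz => hz x hx

theorem vClosure_mono {E F : Set H} (h : E ⊆ F) : vClosure E ⊆ vClosure F := by
  intro x hx
  rw [mem_vClosure] at hx ⊢
  exact fun z hz => hx z fun y hy => hz y (h hy)

theorem vClosure_subset_tClosure {E X : Set H} (hE : E.Finite) (h : E ⊆ X) :
    vClosure E ⊆ tClosure X :=
  fun _ hx => mem_tClosure.2 ⟨E, h, hE, hx⟩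

theorem tClosure_eq_vClosure {E : Set H} (hE : E.Finite) : tClosure E = vClosure E := by
  refine Set.Subset.antisymm (fun x hx => ?_) (vClosure_subset_tClosure hE subset_rfl)
  obtain ⟨F, hF, -, hx⟩ := mem_tClosure.1 hx
  exact vClosure_mono hF hx

theorem subset_tClosure (X : Set H) : X ⊆ tClosure X :=
  fun x hx => mem_tClosure.2 ⟨{x}, by simpa using hx, Set.finite_singleton x,
    mem_vClosure_of_mem rfl⟩

theorem tClosure_mono {X Y : Set H} (h : X ⊆ Y) : tClosure X ⊆ tClosure Y := by
  intro x hx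
  obtain ⟨E, hE, hf, hx⟩ := mem_tClosure.1 hx
  exact mem_tClosure.2 ⟨E, hE.trans h, hf, hx⟩

theorem exists_finite_subset_of_subset_tClosure {X E : Set H} (hE : E.Finite)
    (h : E ⊆ tClosure X) : ∃ F ⊆ X, F.Finite ∧ E ⊆ vClosure F := by
  induction E, hE using Set.Finite.induction_on with
  | empty => exact ⟨∅, by simp, Set.finite_empty, by simp⟩
  | @insert a E ha hE ih =>
    obtain ⟨F, hF, hf, h1⟩ := ih fun e he => h (Set.mem_insert_of_mem a he)
    obtain ⟨F', hF', hf', h2⟩ := mem_tClosure.1 (h (Set.mem_insert a E))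
    refine ⟨F ∪ F', Set.union_subset hF hF', hf.union hf', ?_⟩
    rintro e (rfl | he)
    · exact vClosure_mono Set.subset_union_right h2
    · exact vClosure_mono Set.subset_union_left (h1 he)

theorem tClosure_idem (X : Set H) : tClosure (tClosure X) = tClosure X := by
  refine Set.Subset.antisymm (fun x hx => ?_) (subset_tClosure _)
  obtain ⟨E, hE, hf, hx⟩ := mem_tClosure.1 hx
  obtain ⟨F, hF, hf', hEF⟩ := exists_finite_subset_of_subset_tClosure hf hE
  refine mem_tClosure.2 ⟨F, hF, hf', ?_⟩
  rw [mem_vClosure] at hx ⊢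
  exact fun z hz => hx z fun y hy => mem_vClosure.1 (hEF hy) z hz

theorem isRIdeal_tClosure (X : Set H) : IsRIdeal tClosure (tClosure X) := tClosure_idem X

theorem isRIdeal_of_tClosure_subset {X : Set H} (h : tClosure X ⊆ X) : IsRIdeal tClosure X :=
  h.antisymm (subset_tClosure X)

theorem tClosure_subset {X I : Set H} (hI : IsRIdeal tClosure I) (h : X ⊆ I) : tClosure X ⊆ I := by
  rw [← show tClosure I = I from hI]
  exact tClosure_mono h

theorem mul_mem_tClosure_mul {X Y : Set H} {x y : H} (hx : x ∈ tClosure X) (hy : y ∈ tClosure Y) :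
    x * y ∈ tClosure (X * Y) := by
  obtain ⟨E, hE, hf, hx⟩ := mem_tClosure.1 hx
  obtain ⟨F, hF, hf', hy⟩ := mem_tClosure.1 hy
  refine mem_tClosure.2 ⟨E * F, Set.mul_subset_mul hE hF, hf.mul hf', ?_⟩
  rw [mem_vClosure] at hx hy ⊢
  intro z hz
  have h1 : ∀ e ∈ E, z * toQuotient e * toQuotient y ∈ integers H := by
    intro e he
    refine hy _ fun f hf => ?_
    rw [mul_assoc, ← toQuotient_mul]
    exact hz _ (Set.mul_mem_mul he hf)
  have h2 := hx (z * toQuotient y) fun e he => by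
    rw [mul_right_comm]
    exact h1 e he
  rw [toQuotient_mul]
  convert h2 using 1
  ac_rfl

theorem IsRIdeal.mul_mem_left {I : Set H} (hI : IsRIdeal tClosure I) {x : H} (hx : x ∈ I) (y : H) :
    y * x ∈ I := by
  rw [← show tClosure I = I from hI]
  refine mem_tClosure.2 ⟨{x}, by simpa using hx, Set.finite_singleton x, mem_vClosure.2 ?_⟩
  intro z hz
  rw [toQuotient_mul, mul_left_comm]
  exact mul_mem (toQuotient_mem_integers y) (hz x rfl)

theorem IsRIdeal.mem_of_dvd {I : Set H} (hI : IsRIdeal tClosure I) {x y : H} (hx : x ∈ I)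
    (h : x ∣ y) : y ∈ I := by
  obtain ⟨c, rfl⟩ := h
  rw [mul_comm]
  exact hI.mul_mem_left hx c

theorem IsRIdeal.mem_of_mem_zeroElems {I : Set H} (hI : IsRIdeal tClosure I) {x : H}
    (hx : x ∈ zeroElems H) : x ∈ I := by
  rw [← show tClosure I = I from hI]
  refine mem_tClosure.2 ⟨∅, by simp, Set.finite_empty, mem_vClosure.2 fun z _ => ?_⟩
  obtain ⟨a, b, hb, hz⟩ := exists_mul_toQuotient_eq z
  rw [mul_toQuotient_mem_integers_iff hb hz]
  exact dvd_of_mem_zeroElems (mul_mem_zeroElems_left hx a) b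

theorem IsRIdeal.eq_univ {I : Set H} (hI : IsRIdeal tClosure I) (h : (1 : H) ∈ I) :
    I = Set.univ :=
  Set.eq_univ_of_forall fun x => by simpa using hI.mul_mem_left h x

theorem IsRIdeal.isSIdeal {I : Set H} (hI : IsRIdeal tClosure I) : IsSIdeal I := by
  ext x
  constructor
  · exact fun hx => Or.inl ⟨x, hx, 1, Set.mem_univ _, mul_one x⟩
  · rintro (⟨y, hy, z, -, rfl⟩ | hx)
    · exact hI.mem_of_dvd hy (dvd_mul_right y z)
    · exact hI.mem_of_mem_zeroElems hx

theorem IsRIdeal.colon {I : Set H} (hI : IsRIdeal tClosure I) (x : H) :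
    IsRIdeal tClosure {y : H | y * x ∈ I} := by
  refine isRIdeal_of_tClosure_subset fun y hy => ?_
  have h := mul_mem_tClosure_mul hy (subset_tClosure {x} (Set.mem_singleton x))
  refine tClosure_subset hI ?_ h
  rintro _ ⟨a, ha, b, rfl, rfl⟩
  exact ha

theorem isRIdeal_iInter {ι : Sort*} {I : ι → Set H} (h : ∀ i, IsRIdeal tClosure (I i)) :
    IsRIdeal tClosure (⋂ i, I i) :=
  isRIdeal_of_tClosure_subset (Set.subset_iInter fun i =>
    tClosure_subset (h i) (Set.iInter_subset I i))

theorem isRIdeal_setOf_dvd (c : H) : IsRIdeal tClosure {x : H | c ∣ x} := by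
  refine isRIdeal_of_tClosure_subset fun x hx => ?_
  by_cases hc : c ∈ zeroElems H
  · obtain ⟨E, hE, -, hx⟩ := mem_tClosure.1 hx
    by_contra hxc
    have hx0 : x ∉ zeroElems H := fun h => hxc (dvd_of_mem_zeroElems h c)
    have := hG.out
    simp only [eqQuotient_iff, not_forall] at this
    obtain ⟨d, hd, hu⟩ := this
    -- For a nonzero nonunit d, which exists as H ≠ G, the fraction 1/(xd) carries z(H) into H but
    -- not x.
    obtain ⟨z, hz⟩ := exists_fraction 1 (mul_notMem_zeroElems hx0 hd)
    have h1 := mem_vClosure.1 hx z fun y hy => by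
      rw [mul_toQuotient_mem_integers_iff (mul_notMem_zeroElems hx0 hd) hz, one_mul]
      obtain ⟨e, rfl⟩ := hE hy
      exact dvd_of_mem_zeroElems (mul_mem_zeroElems hc e) _
    rw [mul_toQuotient_mem_integers_iff (mul_notMem_zeroElems hx0 hd) hz, one_mul] at h1
    exact hu (isUnit_of_dvd_one (dvd_of_mul_dvd_mul_left_of_notMem hx0 (by simpa using h1)))
  · obtain ⟨E, hE, -, hx⟩ := mem_tClosure.1 hx
    obtain ⟨z, hz⟩ := exists_fraction 1 hc
    have h1 := mem_vClosure.1 hx z fun y hy => by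
      rw [mul_toQuotient_mem_integers_iff hc hz, one_mul]
      exact hE hy
    rwa [mul_toQuotient_mem_integers_iff hc hz, one_mul] at h1

/-- Not a case of `isRIdeal_setOf_dvd`, as z(H) may be empty. A nonzero x in the closure would lie
in every principal ideal {y | c ∣ y}, in particular for c = xd with d a nonunit. -/
theorem isRIdeal_zeroElems : IsRIdeal tClosure (zeroElems H) := by
  refine isRIdeal_of_tClosure_subset fun x hx => ?_
  by_contra hx0
  have := hG.out
  simp only [eqQuotient_iff, not_forall] at this
  obtain ⟨d, hd, hu⟩ := this
  have h1 := tClosure_subset (isRIdeal_setOf_dvd (x * d))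
    (fun y hy => dvd_of_mem_zeroElems hy (x * d)) hx
  exact hu (isUnit_of_dvd_one (dvd_of_mul_dvd_mul_left_of_notMem hx0 (by simpa using h1)))

theorem IsPrincipal.isRIdeal {I : Set H} (hI : IsPrincipal I) : IsRIdeal tClosure I := by
  obtain rfl | ⟨c, rfl⟩ := hI.eq_or
  · exact isRIdeal_zeroElems
  · exact isRIdeal_setOf_dvd c

theorem IsRIdeal.eq_zeroElems {I : Set H} (hI : IsRIdeal tClosure I) (h : I ⊆ zeroElems H) :
    I = zeroElems H :=
  h.antisymm fun _ hx => hI.mem_of_mem_zeroElems hx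

theorem exists_isRMaximal_superset {I : Set H} (hI : IsRIdeal tClosure I) (h1 : (1 : H) ∉ I) :
    ∃ M, IsRMaximal tClosure M ∧ I ⊆ M := by
  obtain ⟨M, hIM, hM⟩ := zorn_subset_nonempty
    {J : Set H | IsRIdeal tClosure J ∧ J ≠ Set.univ} (fun c hc hchain hne => by
      refine ⟨⋃₀ c, ⟨isRIdeal_of_tClosure_subset fun x hx => ?_, fun h => ?_⟩,
        fun s hs => Set.subset_sUnion_of_mem hs⟩
      · obtain ⟨E, hE, hf, hx⟩ := mem_tClosure.1 hx
        obtain ⟨J, hJ, hEJ⟩ := hchain.directedOn.exists_mem_subset_of_finite_of_subset_sUnion hne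
          hf hE
        exact ⟨J, hJ, tClosure_subset (hc hJ).1 hEJ (vClosure_subset_tClosure hf subset_rfl hx)⟩
      · obtain ⟨J, hJ, h1J⟩ : (1 : H) ∈ ⋃₀ c := h ▸ Set.mem_univ _
        exact (hc hJ).2 ((hc hJ).1.eq_univ h1J)) I ⟨hI, fun h => h1 (h ▸ Set.mem_univ _)⟩
  exact ⟨M, hM, hIM⟩

theorem IsRMaximal.isRIdeal {M : Set H} (hM : IsRMaximal tClosure M) : IsRIdeal tClosure M :=
  hM.prop.1

theorem IsRMaximal.one_notMem {M : Set H} (hM : IsRMaximal tClosure M) : (1 : H) ∉ M :=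
  fun h => hM.prop.2 (hM.isRIdeal.eq_univ h)

/-- If xy ∈ M and y ∉ M, then (M : y) is a proper t-ideal containing M and x, so it equals M. -/
theorem IsRMaximal.isPrimeSIdeal {M : Set H} (hM : IsRMaximal tClosure M) : IsPrimeSIdeal M := by
  refine ⟨hM.isRIdeal.isSIdeal, hM.prop.2, fun x y hxy => ?_⟩
  by_contra! h
  refine h.1 (hM.le_of_ge ⟨hM.isRIdeal.colon y, fun hu => h.2 ?_⟩
    (fun a ha => ?_) hxy)
  · have : (1 : H) ∈ {a : H | a * y ∈ M} := hu ▸ Set.mem_univ _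
    simpa using this
  · change a * y ∈ M
    rw [mul_comm]
    exact hM.isRIdeal.mul_mem_left ha y

theorem IsRMaximal.exists_mem_notMem_zeroElems {M : Set H} (hM : IsRMaximal tClosure M) :
    ∃ x ∈ M, x ∉ zeroElems H := by
  by_contra! h
  have := hG.out
  simp only [eqQuotient_iff, not_forall] at this
  obtain ⟨d, hd, hu⟩ := this
  refine hd (h d (hM.le_of_ge ⟨isRIdeal_setOf_dvd d, fun he => hu ?_⟩ (fun x hx => ?_)
    (dvd_refl d)))
  · exact isUnit_of_dvd_one (he ▸ Set.mem_univ (1 : H) : (1 : H) ∈ {x : H | d ∣ x})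
  · exact dvd_of_mem_zeroElems (h x hx) d

theorem IsRIdeal.one_mem_of_forall_maximal {I : Set H} (hI : IsRIdeal tClosure I)
    (h : ∀ M, IsRMaximal tClosure M → ∃ x ∈ I, x ∉ M) : (1 : H) ∈ I := by
  by_contra h1
  obtain ⟨M, hM, hIM⟩ := exists_isRMaximal_superset hI h1
  obtain ⟨x, hx, hxM⟩ := h M hM
  exact hxM (hIM hx)

/-- The t-ideal (I : x) lies in no t-maximal ideal, so it contains 1. -/
theorem IsRIdeal.mem_of_forall_maximal {I : Set H} (hI : IsRIdeal tClosure I) {x : H}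
    (h : ∀ M, IsRMaximal tClosure M → ∃ s ∉ M, s * x ∈ I) : x ∈ I := by
  have : (1 : H) * x ∈ I := (hI.colon x).one_mem_of_forall_maximal fun M hM => by
    obtain ⟨s, hs, hx⟩ := h M hM
    exact ⟨s, hx, hs⟩
  simpa using this

end TClosure

/-! ### t-invertible t-ideals. -/

section Invertible

variable {H : Type*} [CommMonoid H] [CancellativeOffZero H]

/-- The subset `I I⁻¹` of `H`. -/
def inverseProduct (I : Set H) : Set H :=
  toQuotient ⁻¹' (toQuotient '' I * inverse (toQuotient '' I))

theorem mem_inverseProduct {I : Set H} {h : H} :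
    h ∈ inverseProduct I ↔ ∃ x ∈ I, ∃ z : QuotientMonoid H,
      (∀ y ∈ I, z * toQuotient y ∈ integers H) ∧ z * toQuotient x = toQuotient h := by
  constructor
  · rintro ⟨_, ⟨x, hx, rfl⟩, z, hz, h⟩
    exact ⟨x, hx, z, mem_inverse_image.1 hz, by rw [← h, mul_comm]⟩
  · rintro ⟨x, hx, z, hz, h⟩
    exact ⟨_, ⟨x, hx, rfl⟩, z, mem_inverse_image.2 hz, by rw [← h, mul_comm]⟩

theorem inverse_mul_dvd {x y h : H} {z : QuotientMonoid H}
    (hy : z * toQuotient y ∈ integers H) (hx : z * toQuotient x = toQuotient h) : x ∣ h * y := by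
  obtain ⟨c, hc⟩ := hy
  refine ⟨c, toQuotient_injective ?_⟩
  rw [toQuotient_mul, toQuotient_mul, hc, ← hx]
  ac_rfl

variable [hG : Fact (¬ EqQuotient H)]

theorem isRInvertible_iff {I : Set H} :
    IsRInvertible tClosure I ↔ IsRIdeal tClosure I ∧ (1 : H) ∈ tClosure (inverseProduct I) :=
  and_congr_right fun _ => ⟨fun h => h ▸ Set.mem_univ _,
    fun h => (isRIdeal_tClosure _).eq_univ h⟩

theorem isRInvertible_of_forall_maximal {I : Set H} (hI : IsRIdeal tClosure I)
    (h : ∀ M, IsRMaximal tClosure M → ∃ x ∈ I, ∃ z : QuotientMonoid H,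
      (∀ y ∈ I, z * toQuotient y ∈ integers H) ∧ ∃ s ∉ M, z * toQuotient x = toQuotient s) :
    IsRInvertible tClosure I := by
  refine isRInvertible_iff.2 ⟨hI, (isRIdeal_tClosure _).one_mem_of_forall_maximal fun M hM => ?_⟩
  obtain ⟨x, hx, z, hz, s, hs, h⟩ := h M hM
  exact ⟨s, subset_tClosure _ (mem_inverseProduct.2 ⟨x, hx, z, hz, h⟩), hs⟩

theorem IsRInvertible.exists_notMem {I P : Set H} (hI : IsRInvertible tClosure I)
    (hP : IsRIdeal tClosure P) (h1 : (1 : H) ∉ P) :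
    ∃ x ∈ I, ∃ z : QuotientMonoid H, (∀ y ∈ I, z * toQuotient y ∈ integers H) ∧
      ∃ s ∉ P, z * toQuotient x = toQuotient s := by
  by_contra! h
  refine h1 (tClosure_subset hP (fun s hs => ?_) (isRInvertible_iff.1 hI).2)
  obtain ⟨x, hx, z, hz, hs⟩ := mem_inverseProduct.1 hs
  by_contra hsP
  exact h x hx z hz s hsP hs

/-- Since I I⁻¹ is not contained in P, some s = zx with x ∈ I, z ∈ I⁻¹ avoids P; then sy = x(zy) for
y ∈ I. Thus x generates I locally. -/
theorem IsRInvertible.exists_locally_dvd {I P : Set H} (hI : IsRInvertible tClosure I)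
    (hP : IsRIdeal tClosure P) (h1 : (1 : H) ∉ P) :
    ∃ x ∈ I, ∃ s ∉ P, ∀ y ∈ I, x ∣ s * y := by
  obtain ⟨x, hx, z, hz, s, hs, h⟩ := hI.exists_notMem hP h1
  exact ⟨x, hx, s, hs, fun y hy => inverse_mul_dvd (hz y hy) h⟩

theorem mem_integers_of_one_mem_tClosure {X : Set H} (hX : (1 : H) ∈ tClosure X)
    {w : QuotientMonoid H} (h : ∀ x ∈ X, w * toQuotient x ∈ integers H) : w ∈ integers H := by
  obtain ⟨E, hE, -, h1⟩ := mem_tClosure.1 hX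
  simpa [toQuotient_one] using mem_vClosure.1 h1 w fun y hy => h y (hE hy)

/-- A finite certificate of (I I⁻¹)_t = H, needed because closures are tested on finite sets only.
-/
theorem IsRInvertible.exists_finite {I : Set H} (hI : IsRInvertible tClosure I) :
    ∃ E ⊆ I, E.Finite ∧ ∃ D : Set (QuotientMonoid H), D.Finite ∧
      (∀ z ∈ D, ∀ y ∈ I, z * toQuotient y ∈ integers H) ∧
      ∀ w : QuotientMonoid H, (∀ x ∈ E, ∀ z ∈ D, w * (z * toQuotient x) ∈ integers H) →
        w ∈ integers H := by
  obtain ⟨F, hF, hf, h1⟩ := mem_tClosure.1 (isRInvertible_iff.1 hI).2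
  have h2 : ∀ f : F, ∃ x ∈ I, ∃ z : QuotientMonoid H,
      (∀ y ∈ I, z * toQuotient y ∈ integers H) ∧ z * toQuotient x = toQuotient (f : H) :=
    fun f => mem_inverseProduct.1 (hF f.2)
  choose x hx z hz hxz using h2
  have := hf.to_subtype
  refine ⟨Set.range x, Set.range_subset_iff.2 hx, Set.finite_range x, Set.range z,
    Set.finite_range z, Set.forall_mem_range.2 hz, fun w hw => ?_⟩
  have := mem_vClosure.1 h1 w fun f hf => by
    rw [← hxz ⟨f, hf⟩]
    exact hw _ ⟨_, rfl⟩ _ ⟨_, rfl⟩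
  simpa [toQuotient_one] using this

theorem IsRInvertible.isRFinitelyGenerated {I : Set H} (hI : IsRInvertible tClosure I) :
    IsRFinitelyGenerated tClosure I := by
  obtain ⟨E, hE, hf, D, -, hD, h⟩ := hI.exists_finite
  refine ⟨E, hf, hE, Set.Subset.antisymm (fun x hx => ?_) (tClosure_subset hI.1 hE)⟩
  refine vClosure_subset_tClosure hf subset_rfl (mem_vClosure.2 fun w hw => h _ ?_)
  intro e he z hz
  have : w * toQuotient x * (z * toQuotient e) = w * toQuotient e * (z * toQuotient x) := by
    ac_rfl
  rw [this]
  exact mul_mem (hw e he) (hD z hz x hx)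

/-- Here x⁻¹J ⊆ I⁻¹, so I I⁻¹ contains x⁻¹IJ, whose t-closure contains 1. -/
theorem isRInvertible_of_tClosure_mul_eq {I J : Set H} {x : H} (hx : x ∉ zeroElems H)
    (hI : IsRIdeal tClosure I) (h : tClosure (I * J) = {y : H | x ∣ y}) :
    IsRInvertible tClosure I := by
  refine isRInvertible_iff.2 ⟨hI, ?_⟩
  obtain ⟨E, hE, hf, h1⟩ := mem_tClosure.1 (h ▸ dvd_refl x : x ∈ tClosure (I * J))
  have hdvd : ∀ y ∈ I * J, x ∣ y := fun y hy => (h ▸ subset_tClosure _ hy : y ∈ {y : H | x ∣ y})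
  have hinj : Function.Injective (x * ·) := fun a b hab => cancel_left hx hab
  refine mem_tClosure.2 ⟨(x * ·) ⁻¹' E, fun y hy => ?_, hf.preimage hinj.injOn,
    mem_vClosure.2 fun z hz => ?_⟩
  · obtain ⟨i, hi, j, hj, hij⟩ := hE hy
    obtain ⟨z, hz⟩ := exists_fraction j hx
    refine mem_inverseProduct.2 ⟨i, hi, z, fun y' hy' => ?_, mul_toQuotient_cancel hx ?_⟩
    · rw [mul_toQuotient_mem_integers_iff hx hz, mul_comm]
      exact hdvd _ (Set.mul_mem_mul hy' hj)
    · rw [mul_right_comm, hz, ← toQuotient_mul, ← toQuotient_mul, mul_comm j, mul_comm y]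
      exact congrArg _ hij
  · obtain ⟨v, hv⟩ := exists_inverse_toQuotient hx
    have h2 := mem_vClosure.1 h1 (z * v) fun e he => by
      obtain ⟨y, rfl⟩ := hdvd e (hE he)
      rw [toQuotient_mul, mul_assoc, ← mul_assoc v, hv, one_mul]
      exact hz y he
    rwa [mul_assoc, hv, ← toQuotient_one] at h2

end Invertible

/-! ### Discrete valuations attached to a prime. -/

section Valuation

variable {H : Type*} [CommMonoid H] [CancellativeOffZero H]

/-- The element `p` generates the maximal ideal of the localization at the prime `P`, and no nonzero
element is divisible by all powers of `p` there. -/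
structure IsUniformizer (P : Set H) (p : H) : Prop where
  mem : p ∈ P
  notMem_zeroElems : p ∉ zeroElems H
  exists_dvd : ∀ x ∈ P, ∃ s ∉ P, p ∣ s * x
  exists_not_pow_dvd : ∀ e ∉ zeroElems H, ∃ n : ℕ, ∀ s ∉ P, ¬ p ^ n ∣ s * e

/-- The function `v` is the discrete valuation on `H` attached to the localization at `P`. -/
structure IsLocalValuation (P : Set H) (v : H → ℕ∞) : Prop where
  map_mul : ∀ x y, v (x * y) = v x + v y
  eq_top_iff : ∀ x, v x = ⊤ ↔ x ∈ zeroElems H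
  eq_zero_iff : ∀ x, v x = 0 ↔ x ∉ P
  exists_eq_one : ∃ p, v p = 1
  exists_dvd_of_le : ∀ x y, v x ≤ v y → ∃ s ∉ P, x ∣ s * y

variable {P : Set H}

/-- Take the largest power of p that divides x locally; a cofactor in P would allow one more p to be
split off. -/
theorem IsUniformizer.exists_eq_pow_mul {p : H} (hP : IsPrimeSIdeal P) (h : IsUniformizer P p)
    {x : H} (hx : x ∉ zeroElems H) : ∃ n : ℕ, ∃ s ∉ P, ∃ u ∉ P, s * x = p ^ n * u := by
  classical
  have hex := h.exists_not_pow_dvd x hx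
  have hmin := Nat.find_spec hex
  obtain ⟨n, hn⟩ : ∃ n, Nat.find hex = n + 1 :=
    Nat.exists_eq_succ_of_ne_zero fun h0 => by
      rw [h0] at hmin
      exact hmin 1 hP.one_notMem (by simp)
  have := Nat.find_min hex (m := n) (by omega)
  push Not at this
  obtain ⟨s, hs, u, hu⟩ := this
  refine ⟨n, s, hs, u, fun huP => ?_, hu⟩
  obtain ⟨t, ht, c, hc⟩ := h.exists_dvd u huP
  rw [hn] at hmin
  refine hmin (t * s) (hP.mul_notMem ht hs) ⟨c, ?_⟩
  calc t * s * x = p ^ n * (t * u) := by rw [mul_assoc, hu]; ac_rfl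
    _ = p ^ (n + 1) * c := by rw [hc, pow_succ]; ac_rfl

theorem le_of_pow_mul_eq {p : H} (hP : IsPrimeSIdeal P) (hp : p ∈ P) (hp0 : p ∉ zeroElems H)
    {m n : ℕ} {u c : H} (hu : u ∉ P) (h : p ^ n * u = p ^ m * c) : m ≤ n := by
  by_contra! hlt
  obtain ⟨k, rfl⟩ := Nat.exists_eq_add_of_lt hlt
  refine hu ?_
  have : u = p ^ (k + 1) * c := by
    refine cancel_left (pow_notMem_zeroElems hp0 n) ?_
    rw [h, ← mul_assoc, ← pow_add, add_assoc]
  rw [this, pow_succ, mul_right_comm]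
  exact hP.mul_mem_left hp _

theorem IsUniformizer.eq_of_pow_mul {p x : H} (hP : IsPrimeSIdeal P) (h : IsUniformizer P p)
    {m n : ℕ} {s s' u u' : H} (hs : s ∉ P) (hs' : s' ∉ P) (hu : u ∉ P) (hu' : u' ∉ P)
    (h1 : s * x = p ^ m * u) (h2 : s' * x = p ^ n * u') : m = n := by
  have key : p ^ m * (u * s') = p ^ n * (u' * s) := by
    rw [← mul_assoc, ← mul_assoc, ← h1, ← h2]
    ac_rfl
  exact le_antisymm (le_of_pow_mul_eq hP h.mem h.notMem_zeroElems (hP.mul_notMem hu' hs) key.symm)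
    (le_of_pow_mul_eq hP h.mem h.notMem_zeroElems (hP.mul_notMem hu hs') key)

theorem IsUniformizer.exists_isLocalValuation {p : H} (hP : IsPrimeSIdeal P)
    (h : IsUniformizer P p) : ∃ v, IsLocalValuation P v := by
  classical
  let v : H → ℕ∞ := fun x =>
    if hx : x ∈ zeroElems H then ⊤ else ((h.exists_eq_pow_mul hP hx).choose : ℕ)
  have hv0 : ∀ x ∈ zeroElems H, v x = ⊤ := fun x hx => dif_pos hx
  have hv : ∀ (x s u : H) (n : ℕ), x ∉ zeroElems H → s ∉ P → u ∉ P → s * x = p ^ n * u →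
      v x = n := by
    intro x s u n hx hs hu hn
    obtain ⟨s', hs', u', hu', hn'⟩ := (h.exists_eq_pow_mul hP hx).choose_spec
    simp only [v, dif_neg hx]
    exact congrArg _ (h.eq_of_pow_mul hP hs' hs hu' hu hn' hn)
  refine ⟨v, ?_, ?_, ?_, ⟨p, ?_⟩, ?_⟩
  · intro x y
    by_cases hx : x ∈ zeroElems H
    · rw [hv0 x hx, hv0 _ (mul_mem_zeroElems hx y), top_add]
    by_cases hy : y ∈ zeroElems H
    · rw [hv0 y hy, hv0 _ (mul_mem_zeroElems_left hy x), add_top]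
    obtain ⟨m, s, hs, u, hu, h1⟩ := h.exists_eq_pow_mul hP hx
    obtain ⟨n, t, ht, w, hw, h2⟩ := h.exists_eq_pow_mul hP hy
    rw [hv x s u m hx hs hu h1, hv y t w n hy ht hw h2,
      hv (x * y) (s * t) (u * w) (m + n) (mul_notMem_zeroElems hx hy) (hP.mul_notMem hs ht)
        (hP.mul_notMem hu hw), Nat.cast_add]
    calc s * t * (x * y) = s * x * (t * y) := by ac_rfl
      _ = p ^ (m + n) * (u * w) := by rw [h1, h2, pow_add]; ac_rfl
  · intro x
    refine ⟨fun hx => ?_, hv0 x⟩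
    by_contra hx0
    simp [v, hx0] at hx
  · intro x
    by_cases hx : x ∈ zeroElems H
    · simp [hv0 x hx, hP.mem_of_mem_zeroElems hx]
    obtain ⟨m, s, hs, u, hu, h1⟩ := h.exists_eq_pow_mul hP hx
    rw [hv x s u m hx hs hu h1]
    constructor
    · intro hm hxP
      obtain rfl : m = 0 := by exact_mod_cast hm
      rw [pow_zero, one_mul] at h1
      exact hu (h1 ▸ hP.mul_mem_left hxP s)
    · intro hxP
      have := h.eq_of_pow_mul hP (x := x) (m := 0) hP.one_notMem hs hxP hu (by simp) h1
      simp [← this]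
  · simpa using hv p 1 1 1 h.notMem_zeroElems hP.one_notMem hP.one_notMem (by simp)
  · intro x y hxy
    by_cases hy : y ∈ zeroElems H
    · exact ⟨1, hP.one_notMem, dvd_of_mem_zeroElems (mul_mem_zeroElems_left hy 1) x⟩
    by_cases hx : x ∈ zeroElems H
    · rw [hv0 x hx, top_le_iff] at hxy
      simp [v, hy] at hxy
    obtain ⟨m, s, hs, u, hu, h1⟩ := h.exists_eq_pow_mul hP hx
    obtain ⟨n, t, ht, w, hw, h2⟩ := h.exists_eq_pow_mul hP hy
    rw [hv x s u m hx hs hu h1, hv y t w n hy ht hw h2] at hxy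
    obtain ⟨k, rfl⟩ := Nat.exists_eq_add_of_le (Nat.cast_le.1 hxy)
    refine ⟨u * t, hP.mul_notMem hu ht, p ^ k * s * w, ?_⟩
    calc u * t * y = u * (t * y) := mul_assoc _ _ _
      _ = p ^ m * u * (p ^ k * w) := by rw [h2, pow_add]; ac_rfl
      _ = x * (p ^ k * s * w) := by rw [← h1]; ac_rfl

namespace IsLocalValuation

variable {v : H → ℕ∞}

theorem map_one (h : IsLocalValuation P v) (hP : IsPrimeSIdeal P) : v 1 = 0 :=
  (h.eq_zero_iff 1).2 hP.one_notMem

theorem map_pow (h : IsLocalValuation P v) (hP : IsPrimeSIdeal P) (x : H) (n : ℕ) :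
    v (x ^ n) = n * v x := by
  induction n with
  | zero => simp [h.map_one hP]
  | succ n ih => rw [pow_succ, h.map_mul, ih, Nat.cast_succ, add_mul, one_mul]

theorem map_prod (h : IsLocalValuation P v) (hP : IsPrimeSIdeal P) {ι : Type*} (s : Finset ι)
    (f : ι → H) : v (∏ i ∈ s, f i) = ∑ i ∈ s, v (f i) := by
  classical
  induction s using Finset.induction_on with
  | empty => simp [h.map_one hP]
  | insert a s ha ih => rw [Finset.prod_insert ha, Finset.sum_insert ha, h.map_mul, ih]

theorem one_le_iff (h : IsLocalValuation P v) {x : H} : 1 ≤ v x ↔ x ∈ P := by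
  rw [Order.one_le_iff_ne_zero, Ne, h.eq_zero_iff, not_not]

theorem le_of_dvd (h : IsLocalValuation P v) {x y : H} (hxy : x ∣ y) : v x ≤ v y := by
  obtain ⟨c, rfl⟩ := hxy
  rw [h.map_mul]
  exact le_self_add

theorem map_mul_of_notMem (h : IsLocalValuation P v) {s : H} (hs : s ∉ P) (x : H) :
    v (s * x) = v x := by
  rw [h.map_mul, (h.eq_zero_iff s).2 hs, zero_add]

/-- For finite E of value at least n, a single s ∉ P makes p^n divide sE. The fraction s/p^n carries
E into H, hence also E_v. -/
theorem isRIdeal_setOf_le [Fact (¬ EqQuotient H)] (h : IsLocalValuation P v)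
    (hP : IsPrimeSIdeal P) (n : ℕ) : IsRIdeal tClosure {x : H | n ≤ v x} := by
  obtain ⟨p, hp⟩ := h.exists_eq_one
  have hp0 : p ∉ zeroElems H := fun h0 => by simp [(h.eq_top_iff p).2 h0] at hp
  have hpn : v (p ^ n) = n := by rw [h.map_pow hP, hp, mul_one]
  refine isRIdeal_of_tClosure_subset fun x hx => ?_
  obtain ⟨E, hE, hf, hx⟩ := mem_tClosure.1 hx
  obtain ⟨s, hs, hsE⟩ := hP.exists_uniform_multiplier (X := {y : H | p ^ n ∣ y})
    (fun y hy a => Dvd.dvd.mul_left hy a) hf fun e he =>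
      h.exists_dvd_of_le _ _ (hpn.trans_le (hE he))
  obtain ⟨z, hz⟩ := exists_fraction s (pow_notMem_zeroElems hp0 n)
  have h1 := mem_vClosure.1 hx z fun y hy => by
    rw [mul_toQuotient_mem_integers_iff (pow_notMem_zeroElems hp0 n) hz]
    exact hsE y hy
  rw [mul_toQuotient_mem_integers_iff (pow_notMem_zeroElems hp0 n) hz] at h1
  have := h.le_of_dvd h1
  rwa [hpn, h.map_mul_of_notMem hs] at this

end IsLocalValuation

end Valuation

/-! ### Uniformizers and valuations versus discrete valuation monoids. -/

section Localization

theorem isSIdeal_of_mul_mem {L : Type*} [CommMonoid L] {X : Set L}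
    (h0 : ∀ z ∈ zeroElems L, z ∈ X) (hmul : ∀ x ∈ X, ∀ y, x * y ∈ X) : IsSIdeal X := by
  ext x
  constructor
  · exact fun hx => Or.inl ⟨x, hx, 1, Set.mem_univ _, mul_one x⟩
  · rintro (⟨y, hy, z, -, rfl⟩ | hx)
    · exact hmul y hy z
    · exact h0 x hx

/-- The nonunits form an s-ideal, hence a principal one, generated by π. The common multiples of all
powers of π also form a principal ideal. -/
theorem IsDVM.exists_generator {L : Type*} [CommMonoid L] [CancellativeOffZero L] (h : IsDVM L) :
    ∃ π : L, π ∉ zeroElems L ∧ ¬ IsUnit π ∧ (∀ x, ¬ IsUnit x → π ∣ x) ∧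
      ∀ x, x ∉ zeroElems L → ∃ n : ℕ, ¬ π ^ n ∣ x := by
  obtain ⟨hG, hprin⟩ := h
  rw [eqQuotient_iff] at hG
  push Not at hG
  obtain ⟨d, hd0, hd⟩ := hG
  have hzero : ∀ z ∈ zeroElems L, ¬ IsUnit z := fun z hz hu =>
    one_notMem_zeroElems (by
      obtain ⟨w, hw⟩ := hu.dvd (a := (1 : L))
      rw [hw]
      exact mul_mem_zeroElems hz w)
  obtain ⟨π, hπ⟩ : ∃ π, {x : L | ¬ IsUnit x} = {x | π ∣ x} :=
    (hprin {x : L | ¬ IsUnit x} (isSIdeal_of_mul_mem hzero fun x hx y hu =>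
      hx (isUnit_of_mul_isUnit_left hu))).eq_or.resolve_left
        fun he => hd0 (he ▸ hd : d ∈ zeroElems L)
  have hiff : ∀ x, ¬ IsUnit x ↔ π ∣ x := fun x => Set.ext_iff.1 hπ x
  have hπ0 : π ∉ zeroElems L := notMem_zeroElems_of_dvd hd0 ((hiff d).1 hd)
  refine ⟨π, hπ0, (hiff π).2 dvd_rfl, fun x => (hiff x).1, ?_⟩
  have hY : {x : L | ∀ n : ℕ, π ^ n ∣ x} = zeroElems L := by
    obtain he | ⟨y, hy⟩ := (hprin {x : L | ∀ n : ℕ, π ^ n ∣ x} (isSIdeal_of_mul_mem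
      (fun z hz n => dvd_of_mem_zeroElems hz _) fun x hx y n => (hx n).mul_right y)).eq_or
    · exact he
    · have hiff' : ∀ x, (∀ n : ℕ, π ^ n ∣ x) ↔ y ∣ x := fun x => Set.ext_iff.1 hy x
      have hyn := (hiff' y).2 dvd_rfl
      rw [hy]
      refine setOf_dvd_of_mem_zeroElems ?_
      by_contra hy0
      -- Writing y = πc, the element c is again divisible by all powers of π, so c = ye; cancelling
      -- y makes π a unit.
      obtain ⟨c, hc⟩ := hyn 1
      rw [pow_one] at hc
      obtain ⟨e, rfl⟩ := (hiff' c).1 fun n => by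
        refine dvd_of_mul_dvd_mul_left_of_notMem hπ0 ?_
        rw [← pow_succ', ← hc]
        exact hyn (n + 1)
      have : 1 = π * e := cancel_left hy0 (by rw [mul_one, mul_left_comm]; exact hc)
      exact (hiff π).2 dvd_rfl (IsUnit.of_mul_eq_one e this.symm)
  intro x hx
  by_contra! hn
  exact hx (hY ▸ hn : x ∈ zeroElems L)

variable {H : Type*} [CommMonoid H] [CancellativeOffZero H] {P : Set H} {hP : IsPrimeSIdeal P}

theorem localizationAt_mk_eq_iff {a b : H} {s t : primeCompl P hP} :
    (Localization.mk a s = Localization.mk b t) ↔ (t : H) * a = s * b := by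
  rw [Localization.mk_eq_mk_iff, Localization.r_iff_exists]
  constructor
  · rintro ⟨c, hc⟩
    exact cancel_left (primeCompl_le P hP c.2) hc
  · intro h
    exact ⟨1, by rw [h]⟩

theorem localizationAt_mk_dvd_iff {a b : H} {s t : primeCompl P hP} :
    (Localization.mk a s ∣ Localization.mk b t) ↔ ∃ r ∉ P, a ∣ r * b := by
  constructor
  · rintro ⟨c, hc⟩
    induction c using Localization.induction_on with | _ c
    obtain ⟨c, w⟩ := c
    rw [Localization.mk_mul, localizationAt_mk_eq_iff] at hc
    refine ⟨s * w, (s * w).2, c * t, ?_⟩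
    rw [← Submonoid.coe_mul, ← mul_assoc, mul_comm _ (t : H), hc]
  · rintro ⟨r, hr, c, hc⟩
    refine ⟨Localization.mk (s * c) (⟨r, hr⟩ * t), ?_⟩
    rw [Localization.mk_mul, localizationAt_mk_eq_iff]
    simp only [Submonoid.coe_mul]
    calc (s : H) * (r * t) * b = s * t * (r * b) := by ac_rfl
      _ = t * (a * (s * c)) := by rw [hc]; ac_rfl

theorem localizationAt_mk_mem_zeroElems_iff {a : H} {s : primeCompl P hP} :
    Localization.mk a s ∈ zeroElems (LocalizationAt P hP) ↔ a ∈ zeroElems H := by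
  constructor
  · intro h x
    have := h (Localization.mk x 1)
    rw [Localization.mk_mul, localizationAt_mk_eq_iff, mul_one] at this
    exact cancel_left (primeCompl_le P hP s.2) this
  · intro h x
    induction x using Localization.induction_on with | _ x
    rw [Localization.mk_mul, localizationAt_mk_eq_iff, h, mul_comm, h, mul_comm, h]

theorem localizationAt_isUnit_mk_iff {a : H} {s : primeCompl P hP} :
    IsUnit (Localization.mk a s) ↔ a ∉ P := by
  rw [isUnit_iff_dvd_one, ← Localization.mk_one, localizationAt_mk_dvd_iff]
  constructor
  · rintro ⟨r, hr, h⟩ ha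
    exact hr (hP.mem_of_dvd ha (by simpa using h))
  · exact fun ha => ⟨a, ha, by simp⟩

theorem exists_isUniformizer_of_isDVM (h : IsDVM (LocalizationAt P hP)) :
    ∃ p, IsUniformizer P p := by
  obtain ⟨π, h0, hu, hdvd, hpow⟩ := h.exists_generator
  induction π using Localization.induction_on with | _ π
  obtain ⟨p, s⟩ := π
  refine ⟨p, ?_, ?_, fun x hx => ?_, fun e he => ?_⟩
  · simpa [localizationAt_isUnit_mk_iff] using hu
  · simpa [localizationAt_mk_mem_zeroElems_iff] using h0
  · have := hdvd (Localization.mk x 1) (by simpa [localizationAt_isUnit_mk_iff] using hx)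
    rwa [localizationAt_mk_dvd_iff] at this
  · obtain ⟨n, hn⟩ := hpow (Localization.mk e 1)
      (by rwa [localizationAt_mk_mem_zeroElems_iff])
    rw [Localization.mk_pow, localizationAt_mk_dvd_iff] at hn
    push Not at hn
    exact ⟨n, hn⟩

/-- An s-ideal of the localization is generated by an element whose numerator has least value. -/
theorem IsLocalValuation.isDVM {v : H → ℕ∞} (h : IsLocalValuation P v) :
    IsDVM (LocalizationAt P hP) := by
  constructor
  · obtain ⟨p, hp⟩ := h.exists_eq_one
    rw [eqQuotient_iff]
    intro hu
    have hp0 : p ∉ zeroElems H := fun h0 => by simp [(h.eq_top_iff p).2 h0] at hp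
    have := hu (Localization.mk p 1) (by rwa [localizationAt_mk_mem_zeroElems_iff])
    rw [localizationAt_isUnit_mk_iff, ← h.eq_zero_iff] at this
    simp [hp] at this
  · intro X hX
    have hmul : ∀ x ∈ X, ∀ y, x ∣ y → y ∈ X := by
      rintro x hx _ ⟨c, rfl⟩
      rw [hX]
      exact Or.inl ⟨x, hx, c, Set.mem_univ c, rfl⟩
    by_cases hne : ∃ a : H, ∃ s : primeCompl P hP, Localization.mk a s ∈ X
    · obtain ⟨a, ⟨s, ha⟩, hmin⟩ := exists_minimalFor_of_wellFoundedLT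
        (fun a : H => ∃ s : primeCompl P hP, Localization.mk a s ∈ X) v hne
      have : X = {x | Localization.mk a s ∣ x} := by
        ext x
        refine ⟨fun hx => ?_, fun hx => hmul _ ha x hx⟩
        induction x using Localization.induction_on with | _ x
        obtain ⟨b, t⟩ := x
        exact localizationAt_mk_dvd_iff.2 (h.exists_dvd_of_le _ _
          ((le_total (v a) (v b)).elim id fun hle => hmin ⟨t, hx⟩ hle))
      rw [this]
      exact isPrincipal_dvd _
    · have : X = zeroElems _ := by
        refine Set.Subset.antisymm (fun x hx => (hne ?_).elim) fun x hx => hX ▸ Or.inr hx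
        induction x using Localization.induction_on with | _ x
        exact ⟨x.1, x.2, hx⟩
      rw [this]
      exact ⟨∅, Set.subsingleton_empty, by simp⟩

end Localization

/-! ### Factors of principal ideals. -/

section Products

variable {H : Type*} [CommMonoid H] [CancellativeOffZero H] [hG : Fact (¬ EqQuotient H)]

theorem isRIdeal_univ : IsRIdeal tClosure (Set.univ : Set H) :=
  isRIdeal_of_tClosure_subset (Set.subset_univ _)

theorem isRInvertible_univ : IsRInvertible tClosure (Set.univ : Set H) :=
  isRInvertible_of_forall_maximal isRIdeal_univ fun _ hM =>
    ⟨1, Set.mem_univ 1, 1, fun y _ => by simpa using toQuotient_mem_integers y, 1,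
      hM.one_notMem, one_mul _⟩

variable {n : ℕ} {J : Fin n → Set H} {x : H}

theorem prod_subset (hJ : ∀ i, IsRIdeal tClosure (J i)) (i : Fin n) : ∏ i, J i ⊆ J i := by
  intro y hy
  obtain ⟨g, hg, rfl⟩ := Set.mem_fintype_prod _ _ |>.1 hy
  exact (hJ i).mem_of_dvd (hg i) (Finset.dvd_prod_of_mem g (Finset.mem_univ i))

theorem dvd_prod_of_forall_mem (h : {y : H | x ∣ y} = tClosure (∏ i, J i)) {f : Fin n → H}
    (hf : ∀ i, f i ∈ J i) : x ∣ ∏ i, f i :=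
  (h ▸ subset_tClosure _ ((Set.mem_fintype_prod _ _).2 ⟨f, hf, rfl⟩) :
    (∏ i, f i) ∈ {y : H | x ∣ y})

theorem mem_factor (hJ : ∀ i, IsRIdeal tClosure (J i))
    (h : {y : H | x ∣ y} = tClosure (∏ i, J i)) (i : Fin n) : x ∈ J i :=
  tClosure_subset (hJ i) (prod_subset hJ i) (h ▸ dvd_refl x : x ∈ tClosure (∏ i, J i))

theorem radical_setOf_dvd_eq_iInter (hJ : ∀ i, IsRIdeal tClosure (J i) ∧ IsRadical (J i))
    (h : {y : H | x ∣ y} = tClosure (∏ i, J i)) : radical {y : H | x ∣ y} = ⋂ i, J i := by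
  refine Set.Subset.antisymm ?_ fun y hy => ?_
  · rintro y ⟨k, hk, hy⟩
    refine Set.mem_iInter.2 fun i => isRadical_iff.1 (hJ i).2 y k hk ?_
    exact (hJ i).1.mem_of_dvd (mem_factor (fun i => (hJ i).1) h i) hy
  -- Already x ∣ y^n; the exponent n + 1 covers the empty product, as radicals ask for a positive
  -- exponent.
  · refine ⟨n + 1, Nat.succ_pos n, ?_⟩
    have := dvd_prod_of_forall_mem h (f := fun _ => y) fun i => Set.mem_iInter.1 hy i
    rw [Finset.prod_const, Finset.card_fin] at this
    rw [pow_succ]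
    exact this.mul_right y

theorem isRInvertible_factor (hx : x ∉ zeroElems H) (hJ : ∀ i, IsRIdeal tClosure (J i))
    (h : {y : H | x ∣ y} = tClosure (∏ i, J i)) (i : Fin n) : IsRInvertible tClosure (J i) := by
  refine isRInvertible_of_tClosure_mul_eq (J := ∏ j ∈ Finset.univ.erase i, J j) hx (hJ i) ?_
  rw [Finset.mul_prod_erase _ _ (Finset.mem_univ i), h]

theorem exists_factor_subset {P : Set H} (hP : IsPrimeSIdeal P)
    (h : {y : H | x ∣ y} = tClosure (∏ i, J i)) (hx : x ∈ P) : ∃ i, J i ⊆ P := by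
  by_contra! hn
  choose f hf hfP using fun i => Set.not_subset.1 (hn i)
  exact (primeCompl P hP).prod_mem (t := Finset.univ) (fun i _ => hfP i)
    (hP.mem_of_dvd hx (dvd_prod_of_forall_mem h hf))

/-- The radical is the intersection of the factors. By comparability this is the smallest factor, or
H if there are none. -/
theorem isRInvertible_radical_of_comparable (hx : x ∉ zeroElems H)
    (hJ : ∀ i, IsRIdeal tClosure (J i) ∧ IsRadical (J i)) (hc : ∀ i j, J i ⊆ J j ∨ J j ⊆ J i)
    (h : {y : H | x ∣ y} = tClosure (∏ i, J i)) :
    IsRInvertible tClosure (radical {y : H | x ∣ y}) := by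
  rw [radical_setOf_dvd_eq_iInter hJ h]
  rcases isEmpty_or_nonempty (Fin n) with hn | hn
  · rw [Set.iInter_of_empty]
    exact isRInvertible_univ
  · obtain ⟨i, hi⟩ := Set.finite_univ.exists_minimalFor J Set.univ Set.univ_nonempty
    have hle : ∀ j, J i ⊆ J j := fun j =>
      (hc i j).elim id fun hji => hi.le_of_le (Set.mem_univ j) hji
    rw [show ⋂ j, J j = J i from
      (Set.iInter_subset J i).antisymm (Set.subset_iInter hle)]
    exact isRInvertible_factor hx (fun i => (hJ i).1) h i

end Products

/-! ### Invertible radicals yield uniformizers. -/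

section InvertibleRadicals

variable {H : Type*} [CommMonoid H] [CancellativeOffZero H] [hG : Fact (¬ EqQuotient H)]

/-- For `t`-invertible `K ⊆ I` with `K` radical, `I` and `K I⁻¹` are `t`-coprime. -/
theorem one_mem_tClosure_union {I K : Set H} (hI : IsRInvertible tClosure I)
    (hK : IsRInvertible tClosure K) (hKI : K ⊆ I) (hrad : IsRadical K) :
    (1 : H) ∈ tClosure (I ∪ {l | ∃ k ∈ K, ∃ j : QuotientMonoid H,
      (∀ y ∈ I, j * toQuotient y ∈ integers H) ∧ j * toQuotient k = toQuotient l}) := by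
  obtain ⟨E, hE, hf, D, hDf, hD, h1⟩ := hI.exists_finite
  obtain ⟨E', hE', hf', D', -, hD', h2⟩ := hK.exists_finite
  refine mem_tClosure.2 ⟨E ∪ toQuotient ⁻¹' (D * toQuotient '' E'),
    Set.union_subset_union hE ?_, hf.union ((hDf.mul (hf'.image _)).preimage
      toQuotient_injective.injOn), mem_vClosure.2 fun w hw => ?_⟩
  · rintro l ⟨j, hj, _, ⟨k, hk, rfl⟩, hl⟩
    exact ⟨k, hE' hk, j, hD j hj, hl⟩
  have hwE : ∀ x ∈ E, w * toQuotient x ∈ integers H := fun x hx => hw x (Or.inl hx)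
  have hwI : ∀ y ∈ I, w * toQuotient y ∈ integers H := fun y hy => h1 _ fun x hx j hj => by
    convert mul_mem (hwE x hx) (hD j hj y hy) using 1
    ac_rfl
  have hwKD : ∀ k ∈ K, ∀ j ∈ D, w * (j * toQuotient k) ∈ integers H :=
    fun k hk j hj => h2 _ fun κ hκ μ hμ => by
      obtain ⟨l, hl⟩ := hD j hj κ (hKI (hE' hκ))
      have := hw l (Or.inr ⟨j, hj, _, ⟨κ, hκ, rfl⟩, hl.symm⟩)
      rw [hl] at this
      convert mul_mem this (hD' μ hμ k hk) using 1
      ac_rfl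
  have hwK : ∀ k ∈ K, ∀ j : QuotientMonoid H, (∀ y ∈ I, j * toQuotient y ∈ integers H) →
      w * (j * toQuotient k) ∈ integers H := fun k hk j hj => h1 _ fun x hx j' hj' => by
    convert mul_mem (hwKD k hk j' hj') (hj x (hE hx)) using 1
    ac_rfl
  -- The element c = wijk satisfies c² = k · (wjk)(wi)(ji), a multiple of k in H, so radicality of K
  -- puts c into K.
  have hmem : ∀ i ∈ I, ∀ k ∈ K, ∀ j : QuotientMonoid H,
      (∀ y ∈ I, j * toQuotient y ∈ integers H) → ∀ c : H,
      w * (toQuotient i * (j * toQuotient k)) = toQuotient c → c ∈ K := by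
    intro i hi k hk j hj c hc
    obtain ⟨a, ha⟩ := hwI i hi
    obtain ⟨b, hb⟩ := hwK k hk j hj
    obtain ⟨m, hm⟩ := hj i hi
    refine isRadical_iff.1 hrad c 2 two_pos (hK.1.mem_of_dvd hk ⟨b * a * m, ?_⟩)
    refine toQuotient_injective ?_
    simp only [pow_two, toQuotient_mul]
    rw [ha, hb, hm, ← hc]
    ac_rfl
  rw [toQuotient_one, mul_one]
  refine h2 w fun κ hκ μ hμ => ?_
  obtain ⟨c, hc⟩ : w * toQuotient κ ∈ integers H := hwI κ (hKI (hE' hκ))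
  -- It is enough that wK ⊆ K, since then w K K⁻¹ ⊆ H and w ∈ H. The previous step gives w K I I⁻¹ ⊆
  -- K, and I I⁻¹ has t-closure H.
  suffices hcK : c ∈ K by
    rw [mul_left_comm, ← hc]
    exact hD' μ hμ c hcK
  have : (1 : H) * c ∈ K := by
    refine tClosure_subset (hK.1.colon c) (fun h hh => ?_) (isRInvertible_iff.1 hI).2
    obtain ⟨i, hi, j, hj, hij⟩ := mem_inverseProduct.1 hh
    refine hmem i hi κ (hE' hκ) j hj _ ?_
    rw [toQuotient_mul, hc, ← hij]
    ac_rfl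
  simpa using this

variable (h4 : ∀ x : H, x ∉ zeroElems H → IsRInvertible tClosure (radical {y : H | x ∣ y}))
include h4

/-- With I = √(xH) ⊆ M and K = √(xzH), coprimality provides s ∈ K I⁻¹ outside M, and sI ⊆ K ⊆ √(zH).
Hence all nonzero elements of M have locally the same radical. -/
theorem exists_mul_mem_radical {M : Set H} (hM : IsRMaximal tClosure M) {x z : H}
    (hx : x ∉ zeroElems H) (hz : z ∉ zeroElems H) (hxM : x ∈ M) :
    ∃ s ∉ M, ∀ y ∈ radical {y : H | x ∣ y}, s * y ∈ radical {y : H | z ∣ y} := by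
  have hK := h4 (x * z) (mul_notMem_zeroElems hx hz)
  have hle : ∀ w, w ∣ x * z → radical {y : H | x * z ∣ y} ⊆ radical {y : H | w ∣ y} :=
    fun w hw y ⟨n, hn, hy⟩ => ⟨n, hn, hw.trans hy⟩
  have h1 := one_mem_tClosure_union (h4 x hx) hK (hle x (dvd_mul_right x z))
    (isRadical_radical _)
  by_contra! hcon
  refine hM.one_notMem (tClosure_subset hM.isRIdeal (Set.union_subset ?_ ?_) h1)
  · rintro y ⟨n, hn, hy⟩
    by_contra hyM
    exact hM.isPrimeSIdeal.pow_notMem hyM n (hM.isPrimeSIdeal.mem_of_dvd hxM hy)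
  · rintro l ⟨k, hk, j, hj, hl⟩
    by_contra hlM
    obtain ⟨y, hy, hly⟩ := hcon l hlM
    obtain ⟨c, hc⟩ := hj y hy
    refine hly (hle z (dvd_mul_left z x) (hK.1.mem_of_dvd hk ⟨c, toQuotient_injective ?_⟩))
    rw [toQuotient_mul, toQuotient_mul, ← hl, hc]
    ac_rfl

/-- A local generator p of √(xH) works: every m ∈ M lies locally in √(xH). For e ≠ 0, locally p ∈
√(eH), so e divides some (tp)^n, which excludes p^(n+1) dividing e locally. -/
theorem exists_isUniformizer {M : Set H} (hM : IsRMaximal tClosure M) :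
    ∃ p, IsUniformizer M p := by
  have hP := hM.isPrimeSIdeal
  obtain ⟨x, hxM, hx⟩ := hM.exists_mem_notMem_zeroElems
  obtain ⟨p, hp, s, hs, hps⟩ := (h4 x hx).exists_locally_dvd hM.isRIdeal hM.one_notMem
  have hp0 : p ∉ zeroElems H := notMem_zeroElems_of_dvd
    (mul_notMem_zeroElems (hP.notMem_zeroElems hs) hx) (hps x (subset_radical _ (dvd_refl x)))
  have hpM : p ∈ M := by
    obtain ⟨n, -, hn⟩ := hp
    by_contra h
    exact hP.pow_notMem h n (hP.mem_of_dvd hxM hn)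
  refine ⟨p, hpM, hp0, fun m hm => ?_, fun e he => ?_⟩
  · by_cases hm0 : m ∈ zeroElems H
    · exact ⟨1, hP.one_notMem, dvd_of_mem_zeroElems (mul_mem_zeroElems_left hm0 1) p⟩
    obtain ⟨t, ht, htm⟩ := exists_mul_mem_radical h4 hM hm0 hx hm
    refine ⟨s * t, hP.mul_notMem hs ht, ?_⟩
    rw [mul_assoc]
    exact hps _ (htm m (subset_radical _ (dvd_refl m)))
  · obtain ⟨t, ht, htp⟩ := exists_mul_mem_radical h4 hM hx he hxM
    obtain ⟨n, hn, r, hr⟩ := htp p hp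
    refine ⟨n + 1, fun u hu hdvd => ?_⟩
    have : p ^ n * p ∣ p ^ n * (u * t ^ n) := by
      rw [← pow_succ]
      refine hdvd.trans ⟨r, ?_⟩
      rw [mul_assoc, ← hr, mul_pow]
      ac_rfl
    exact hP.mul_notMem hu (hP.pow_notMem ht n)
      (hP.mem_of_dvd hpM (dvd_of_mul_dvd_mul_left_of_notMem (pow_notMem_zeroElems hp0 n) this))

end InvertibleRadicals

/-! ### Factoring t-ideals into chains of radical t-ideals. -/

section Factorization

variable {H : Type*} [CommMonoid H] [CancellativeOffZero H]

/-- If n = v(x) > 0 and v(p) = 1, then x divides sp^n for some s ∉ P, so sp lies in the radical. -/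
theorem IsLocalValuation.exists_mem_radical {P : Set H} {v : H → ℕ∞} (h : IsLocalValuation P v)
    (hP : IsPrimeSIdeal P) {x : H} (hx : x ∉ zeroElems H) (hxP : x ∈ P) :
    ∃ y ∈ radical {y : H | x ∣ y}, v y = 1 := by
  obtain ⟨n, hn⟩ := ENat.ne_top_iff_exists.1 (mt (h.eq_top_iff x).1 hx)
  obtain ⟨p, hp⟩ := h.exists_eq_one
  obtain ⟨s, hs, hdvd⟩ := h.exists_dvd_of_le x (p ^ n) (by rw [h.map_pow hP, hp, mul_one, hn])
  have hn0 : n ≠ 0 := by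
    rintro rfl
    exact (h.eq_zero_iff x).1 hn.symm hxP
  refine ⟨s * p, ⟨n, Nat.pos_of_ne_zero hn0, ?_⟩, by rw [h.map_mul_of_notMem hs, hp]⟩
  rw [Set.mem_ofPred_eq, mul_pow]
  obtain ⟨m, rfl⟩ := Nat.exists_eq_succ_of_ne_zero hn0
  rw [pow_succ s, mul_assoc]
  exact hdvd.mul_left _

variable [hG : Fact (¬ EqQuotient H)]
variable (h4 : ∀ x : H, x ∉ zeroElems H → IsRInvertible tClosure (radical {y : H | x ∣ y}))
  {v : Set H → H → ℕ∞} (hv : ∀ M, IsRMaximal tClosure M → IsLocalValuation M (v M))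
include h4 hv

/-- Induction on v_M(a), dividing a by its radical. A suitable z ∈ (√(aH))⁻¹ turns a into a' = za,
whose value is one less at M and drops by at most one at any other M' containing a. Once the value
at M is 0, the element itself serves as c. -/
theorem exists_notMem_of_lt {M : Set H} (hM : IsRMaximal tClosure M) (j : ℕ) :
    ∀ (k : ℕ) (a : H), v M a = j → j < k →
      ∃ c ∉ M, ∀ M', IsRMaximal tClosure M' → k ≤ v M' a → c ∈ M' := by
  have hP := hM.isPrimeSIdeal
  induction j with
  | zero =>
    intro k a ha hk
    refine ⟨a, ((hv M hM).eq_zero_iff a).1 ha, fun M' hM' hle => ?_⟩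
    refine (hv M' hM').one_le_iff.1 (le_trans ?_ hle)
    exact_mod_cast hk
  | succ j ih =>
    intro k a ha hk
    have ha0 : a ∉ zeroElems H := fun h0 => by
      rw [((hv M hM).eq_top_iff a).2 h0] at ha
      exact ENat.top_ne_natCast _ ha
    have haM : a ∈ M := by
      rw [← (hv M hM).one_le_iff, ha]
      exact_mod_cast Nat.le_add_left 1 j
    obtain ⟨x, hx, z, hz, s, hs, hzx⟩ := (h4 a ha0).exists_notMem hM.isRIdeal hM.one_notMem
    have haI : a ∈ radical {y : H | a ∣ y} := subset_radical _ (dvd_refl a)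
    obtain ⟨a', ha'⟩ := hz a haI
    have key : ∀ y c : H, z * toQuotient y = toQuotient c → a' * y = c * a := by
      intro y c hy
      refine toQuotient_injective ?_
      rw [toQuotient_mul, toQuotient_mul, ha', ← hy]
      ac_rfl
    have hxone : v M x = 1 := by
      refine le_antisymm ?_ ((hv M hM).one_le_iff.2 ?_)
      · obtain ⟨y, hy, hy1⟩ := (hv M hM).exists_mem_radical hP ha0 haM
        rw [← hy1, ← (hv M hM).map_mul_of_notMem hs y]
        exact (hv M hM).le_of_dvd (inverse_mul_dvd (hz y hy) hzx)
      · obtain ⟨n, -, hn⟩ := hx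
        by_contra hxM
        exact hP.pow_notMem hxM n (hP.mem_of_dvd haM hn)
    have hva' : v M a' = j := by
      have := congrArg (v M) (key x s hzx)
      rw [(hv M hM).map_mul, hxone, (hv M hM).map_mul_of_notMem hs, ha, Nat.cast_succ] at this
      exact WithTop.add_right_cancel ENat.one_ne_top this
    obtain ⟨k, rfl⟩ : ∃ k', k = k' + 1 := ⟨k - 1, by omega⟩
    obtain ⟨c, hc, hcM⟩ := ih k a' hva' (by omega)
    refine ⟨c, hc, fun M' hM' hle => hcM M' hM' ?_⟩
    have hv' := hv M' hM'
    have haM' : a ∈ M' := hv'.one_le_iff.1 (le_trans (by exact_mod_cast Nat.le_add_left 1 k) hle)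
    obtain ⟨y, hy, hy1⟩ := hv'.exists_mem_radical hM'.isPrimeSIdeal ha0 haM'
    obtain ⟨b, hb⟩ := hz y hy
    have := congrArg (v M') (key y b hb.symm)
    rw [hv'.map_mul, hv'.map_mul, hy1] at this
    refine (ENat.add_le_add_iff_right ENat.one_ne_top).1 ?_
    rw [this, ← Nat.cast_one, ← Nat.cast_add]
    exact hle.trans le_add_self

/-- The radical of xH is t-generated by a finite set E. If x ∈ M, some e ∈ E has value at most 1,
for otherwise the t-ideal {v_M ≥ 2} would contain the radical, which has an element of value 1. As x
divides e^(n_e), this gives v_M(x) ≤ n_e. -/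
theorem exists_bound {x : H} (hx : x ∉ zeroElems H) :
    ∃ N : ℕ, ∀ M, IsRMaximal tClosure M → v M x ≤ N := by
  obtain ⟨E, hf, hE, hEI⟩ := (h4 x hx).isRFinitelyGenerated
  have h1 : ∀ e : E, ∃ n : ℕ, x ∣ (e : H) ^ n := fun e => by
    obtain ⟨n, -, hn⟩ := hE e.2
    exact ⟨n, hn⟩
  choose n hn using h1
  have := hf.fintype
  refine ⟨∑ e, n e, fun M hM => ?_⟩
  have hP := hM.isPrimeSIdeal
  by_cases hxM : x ∈ M
  · obtain ⟨y, hy, hy1⟩ := (hv M hM).exists_mem_radical hP hx hxM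
    obtain ⟨e, he, he1⟩ : ∃ e ∈ E, v M e ≤ 1 := by
      by_contra! hlt
      have h2 := tClosure_subset ((hv M hM).isRIdeal_setOf_le hP 2)
        (fun e he => Order.add_one_le_of_lt (hlt e he) : E ⊆ _) (hEI ▸ hy)
      rw [Set.mem_ofPred_eq, hy1] at h2
      exact absurd h2 (by decide)
    refine ((hv M hM).le_of_dvd (hn ⟨e, he⟩)).trans ?_
    rw [(hv M hM).map_pow hP]
    refine (mul_le_mul_right he1 _).trans ?_
    rw [mul_one]
    exact_mod_cast Finset.single_le_sum (f := n) (fun _ _ => Nat.zero_le _)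
      (Finset.mem_univ (⟨e, he⟩ : E))
  · rw [((hv M hM).eq_zero_iff x).2 hxM]
    exact zero_le

/-- Let m be the least value of I at M. Locally J_k has least value 1 for k < m and 0 for k ≥ m, so
the product of the J_k has least value m, like I. Both inclusions follow by the local-global
principle. -/
theorem isFiniteProductOfComparableRadicals {I : Set H} (hI : IsRIdeal tClosure I) :
    IsFiniteProductOfComparableRadicals tClosure I := by
  by_cases hI0 : I ⊆ zeroElems H
  · rw [hI.eq_zeroElems hI0]
    exact ⟨1, fun _ => zeroElems H, fun _ => ⟨isRIdeal_zeroElems, isRadical_zeroElems⟩,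
      fun _ _ => Or.inl subset_rfl, by simpa using isRIdeal_zeroElems.symm⟩
  obtain ⟨x, hxI, hx⟩ := Set.not_subset.1 hI0
  obtain ⟨N, hN⟩ := exists_bound h4 hv hx
  -- Index k stands for level k + 1, since `Fin N` starts at 0. If no M reaches this level, then J k
  -- = H.
  let J : Fin N → Set H := fun k => {h | ∀ M, IsRMaximal tClosure M →
    (∀ a ∈ I, ((k : ℕ) + 1 : ℕ) ≤ v M a) → h ∈ M}
  have hJ : ∀ k h, h ∈ J k ↔ ∀ M, IsRMaximal tClosure M →
      (∀ a ∈ I, ((k : ℕ) + 1 : ℕ) ≤ v M a) → h ∈ M := fun _ _ => Iff.rfl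
  refine ⟨N, J, fun k => ⟨?_, ?_⟩, fun k l => ?_, ?_⟩
  · refine isRIdeal_of_tClosure_subset fun y hy M hM hk => ?_
    exact tClosure_subset hM.isRIdeal (fun h hh => (hJ k h).1 hh M hM hk) hy
  · refine isRadical_iff.2 fun y n _ hy M hM hk => ?_
    by_contra hyM
    exact hM.isPrimeSIdeal.pow_notMem hyM n (hy M hM hk)
  · have hmono : ∀ k l : Fin N, k ≤ l → J k ⊆ J l := by
      intro k l hkl h hh
      rw [hJ] at hh ⊢
      exact fun M hM hl => hh M hM fun a ha =>
        le_trans (by exact_mod_cast Nat.succ_le_succ hkl) (hl a ha)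
    exact (le_total k l).imp (hmono k l) (hmono l k)
  have hmin : ∀ M, IsRMaximal tClosure M → ∃ a ∈ I, ∃ m : ℕ, m ≤ N ∧ v M a = m ∧
      ∀ b ∈ I, (m : ℕ∞) ≤ v M b := by
    intro M hM
    obtain ⟨a, ha, hle⟩ := exists_minimalFor_of_wellFoundedLT (· ∈ I) (v M) ⟨x, hxI⟩
    have hle' : ∀ b ∈ I, v M a ≤ v M b := fun b hb =>
      (le_total (v M a) (v M b)).elim id fun h => hle hb h
    have haN := (hle' x hxI).trans (hN M hM)
    obtain ⟨m, hm⟩ := ENat.ne_top_iff_exists.1 (ne_top_of_le_ne_top (ENat.natCast_ne_top N) haN)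
    rw [← hm] at haN hle'
    exact ⟨a, ha, m, by exact_mod_cast haN, hm.symm, hle'⟩
  have hsum : ∀ m ≤ N, ∑ k : Fin N, (if (k : ℕ) + 1 ≤ m then (1 : ℕ∞) else 0) = m := by
    intro m hm
    rw [Fin.sum_univ_eq_sum_range (fun k => if k + 1 ≤ m then (1 : ℕ∞) else 0) N,
      Finset.sum_boole]
    congr 1
    rw [show (Finset.range N).filter (fun k => k + 1 ≤ m) = Finset.range m by
      ext k
      simp only [Finset.mem_filter, Finset.mem_range]
      omega, Finset.card_range]
  refine Set.Subset.antisymm (fun b hb => ?_) (tClosure_subset hI fun y hy => ?_)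
  · refine (isRIdeal_tClosure _).mem_of_forall_maximal fun M hM => ?_
    have hP := hM.isPrimeSIdeal
    obtain ⟨a, ha, m, hmN, hm, hle⟩ := hmin M hM
    have hfac : ∀ k : Fin N, ∃ h ∈ J k, v M h ≤ if (k : ℕ) + 1 ≤ m then 1 else 0 := by
      intro k
      split_ifs with hk
      · have hxM : x ∈ M := (hv M hM).one_le_iff.1
          (le_trans (by exact_mod_cast (by omega : 1 ≤ m)) (hle x hxI))
        obtain ⟨y, ⟨n, hn, hy⟩, hy1⟩ := (hv M hM).exists_mem_radical hP hx hxM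
        refine ⟨y, fun M' hM' hk' => ?_, hy1.le⟩
        have hxM' : x ∈ M' := (hv M' hM').one_le_iff.1
          (le_trans (by exact_mod_cast Nat.le_add_left 1 _) (hk' x hxI))
        by_contra hyM'
        exact hM'.isPrimeSIdeal.pow_notMem hyM' n (hM'.isPrimeSIdeal.mem_of_dvd hxM' hy)
      -- The local minimizer a alone suffices: if all of I has value at least k + 1 at M', so does
      -- a.
      · obtain ⟨c, hc, hcM⟩ := exists_notMem_of_lt h4 hv hM m ((k : ℕ) + 1) a hm (by omega)
        exact ⟨c, fun M' hM' hk' => hcM M' hM' (hk' a ha),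
          (((hv M hM).eq_zero_iff c).2 hc).le⟩
    choose f hfJ hf using hfac
    obtain ⟨s, hs, hdvd⟩ := (hv M hM).exists_dvd_of_le (∏ k, f k) b (by
      rw [(hv M hM).map_prod hP]
      exact ((Finset.sum_le_sum fun k _ => hf k).trans (hsum m hmN).le).trans (hle b hb))
    exact ⟨s, hs, (isRIdeal_tClosure _).mem_of_dvd
      (subset_tClosure _ ((Set.mem_fintype_prod _ _).2 ⟨f, hfJ, rfl⟩)) hdvd⟩
  · obtain ⟨f, hf, rfl⟩ := (Set.mem_fintype_prod _ _).1 hy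
    refine hI.mem_of_forall_maximal fun M hM => ?_
    have hP := hM.isPrimeSIdeal
    obtain ⟨a, ha, m, hmN, hm, hle⟩ := hmin M hM
    obtain ⟨s, hs, hdvd⟩ := (hv M hM).exists_dvd_of_le a (∏ k, f k) (by
      rw [(hv M hM).map_prod hP, hm, ← hsum m hmN]
      refine Finset.sum_le_sum fun k _ => ?_
      split_ifs with hk
      · refine (hv M hM).one_le_iff.2 (hf k M hM fun b hb => le_trans ?_ (hle b hb))
        exact_mod_cast hk
      · exact zero_le)
    exact ⟨s, hs, hI.mem_of_dvd ha hdvd⟩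

end Factorization

/-! ### Locally total divisibility gives finite conductor. -/

section FiniteConductor

variable {H : Type*} [CommMonoid H] [CancellativeOffZero H]

theorem singleton_mul_univ_eq (x : H) : ({x} * Set.univ : Set H) = {y | x ∣ y} := by
  ext y
  simp [Set.singleton_mul, dvd_def, eq_comm]

theorem isFiniteConductor_iff {r : Set H → Set H} : IsFiniteConductor r ↔
    ∀ x y : H, IsRFinitelyGenerated r ({c | x ∣ c} ∩ {c | y ∣ c}) := by
  simp only [IsFiniteConductor, singleton_mul_univ_eq]

variable [hG : Fact (¬ EqQuotient H)]

theorem isRFinitelyGenerated_zeroElems : IsRFinitelyGenerated tClosure (zeroElems H) :=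
  ⟨∅, Set.finite_empty, Set.empty_subset _, Set.Subset.antisymm
    (fun _ hx => (isRIdeal_tClosure _).mem_of_mem_zeroElems hx)
    (tClosure_subset isRIdeal_zeroElems (Set.empty_subset _))⟩

/-- For nonzero x and y, xH ∩ yH is generated at M by sy or sx, and 1/y or 1/x in its inverse sends
this generator to s ∉ M. So it is t-invertible, hence t-finitely generated. -/
theorem isFiniteConductor_of_locally_total (h : ∀ M : Set H, IsRMaximal tClosure M → ∀ x y : H,
    ∃ s ∉ M, x ∣ s * y ∨ y ∣ s * x) : IsFiniteConductor (tClosure (H := H)) := by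
  rw [isFiniteConductor_iff]
  have hC : ∀ x y : H, IsRIdeal tClosure ({c | x ∣ c} ∩ {c | y ∣ c}) := fun x y =>
    isRIdeal_of_tClosure_subset (Set.subset_inter
      (tClosure_subset (isRIdeal_setOf_dvd x) Set.inter_subset_left)
      (tClosure_subset (isRIdeal_setOf_dvd y) Set.inter_subset_right))
  intro x y
  by_cases hx : x ∈ zeroElems H
  · rw [(hC x y).eq_zeroElems (Set.inter_subset_left.trans
      (setOf_dvd_of_mem_zeroElems hx).subset)]
    exact isRFinitelyGenerated_zeroElems
  by_cases hy : y ∈ zeroElems H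
  · rw [(hC x y).eq_zeroElems (Set.inter_subset_right.trans
      (setOf_dvd_of_mem_zeroElems hy).subset)]
    exact isRFinitelyGenerated_zeroElems
  refine (isRInvertible_of_forall_maximal (hC x y) fun M hM => ?_).isRFinitelyGenerated
  obtain ⟨s, hs, hdvd | hdvd⟩ := h M hM x y
  · obtain ⟨z, hz⟩ := exists_fraction 1 hy
    refine ⟨s * y, ⟨hdvd, dvd_mul_left y s⟩, z, fun c hc => ?_, s, hs, ?_⟩
    · rw [mul_toQuotient_mem_integers_iff hy hz, one_mul]
      exact hc.2
    · rw [toQuotient_mul, mul_left_comm, hz, toQuotient_one, mul_one]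
  · obtain ⟨z, hz⟩ := exists_fraction 1 hx
    refine ⟨s * x, ⟨dvd_mul_left x s, hdvd⟩, z, fun c hc => ?_, s, hs, ?_⟩
    · rw [mul_toQuotient_mem_integers_iff hx hz, one_mul]
      exact hc.1
    · rw [toQuotient_mul, mul_left_comm, hz, toQuotient_one, mul_one]

end FiniteConductor

/-! ### Factoring principal ideals: complete integral closure and local divisibility. -/

section PrincipalFactorization

variable {H : Type*} [CommMonoid H] [CancellativeOffZero H] [hG : Fact (¬ EqQuotient H)]

/-- A radical `t`-ideal is the intersection of primes that localize to its localizations. -/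
theorem exists_prime_of_notMem_radical {B : Set H} (hB : IsRIdeal tClosure B) (hrad : IsRadical B)
    {a : H} (ha : a ∉ B) : ∃ P, IsPrimeSIdeal P ∧ IsRIdeal tClosure P ∧ a ∉ P ∧ B ⊆ P ∧
      ∀ x ∈ P, ∃ s ∉ P, s * x ∈ B := by
  -- P is the complement of a submonoid S maximal among those containing a and missing B. If x ∉ S,
  -- then S and x generate some sx^n ∈ B, whence sx ∈ B by radicality.
  obtain ⟨S, haS, hS⟩ := zorn_le_nonempty₀ {S : Submonoid H | ∀ x ∈ S, x ∉ B}
    (fun c hc hchain T hT => ⟨sSup c, fun x hx => by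
      obtain ⟨U, hU, hxU⟩ := (Submonoid.mem_sSup_of_directedOn ⟨T, hT⟩ hchain.directedOn).1 hx
      exact hc hU x hxU, fun U hU => le_sSup hU⟩) (Submonoid.powers a) (by
    rintro _ ⟨n, rfl⟩ hn
    rcases Nat.eq_zero_or_pos n with rfl | hpos
    · exact ha (hB.mem_of_dvd hn (by simp))
    · exact ha (isRadical_iff.1 hrad a n hpos hn))
  have hloc : ∀ x, x ∉ S → ∃ s ∈ S, s * x ∈ B := by
    intro x hx
    have h1 : ¬ ∀ y ∈ S ⊔ Submonoid.powers x, y ∉ B := fun hcon =>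
      hx (hS.le_of_ge hcon le_sup_left
        ((le_sup_right : _ ≤ S ⊔ Submonoid.powers x) (Submonoid.mem_powers x)))
    push Not at h1
    obtain ⟨y, hy, hyB⟩ := h1
    obtain ⟨s, hs, _, ⟨n, rfl⟩, rfl⟩ := Submonoid.mem_sup.1 hy
    refine ⟨s, hs, isRadical_iff.1 hrad _ (n + 1) n.succ_pos (hB.mem_of_dvd hyB ⟨s ^ n * x, ?_⟩)⟩
    rw [mul_pow, pow_succ, pow_succ]
    change _ = s * x ^ n * _
    ac_rfl
  have hmul : ∀ x, x ∉ S → ∀ y, x * y ∉ S := by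
    intro x hx y hxy
    obtain ⟨s, hs, hsx⟩ := hloc x hx
    exact hS.prop _ (mul_mem hs hxy) (hB.mem_of_dvd hsx ⟨y, by rw [mul_assoc]⟩)
  have hBS : B ⊆ (S : Set H)ᶜ := fun x hx hxS => hS.prop x hxS hx
  have hP : IsPrimeSIdeal (S : Set H)ᶜ := by
    refine ⟨isSIdeal_of_mul_mem (fun z hz => hBS (hB.mem_of_mem_zeroElems hz)) hmul,
      fun h => (h ▸ Set.mem_univ (1 : H) : (1 : H) ∈ (S : Set H)ᶜ) S.one_mem, fun x y hxy => ?_⟩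
    by_contra! hcon
    exact hxy (S.mul_mem (not_not.1 hcon.1) (not_not.1 hcon.2))
  have hloc' : ∀ x ∈ (S : Set H)ᶜ, ∃ s ∉ (S : Set H)ᶜ, s * x ∈ B := fun x hx => by
    obtain ⟨s, hs, h⟩ := hloc x hx
    exact ⟨s, not_not.2 hs, h⟩
  refine ⟨(S : Set H)ᶜ, hP, isRIdeal_of_tClosure_subset fun x hx => ?_,
    not_not.2 (haS (Submonoid.mem_powers a)), hBS, hloc'⟩
  obtain ⟨E, hE, hf, hx⟩ := mem_tClosure.1 hx
  obtain ⟨s, hs, hsE⟩ := hP.exists_uniform_multiplier (fun x hx y => hB.mul_mem_left hx y) hf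
    fun e he => hloc' e (hE he)
  have h1 : x * s ∈ B := tClosure_subset (hB.colon s)
    (fun e he => by
      change e * s ∈ B
      rw [mul_comm]
      exact hsE e he) (vClosure_subset_tClosure hf subset_rfl hx)
  exact (hP.mem_or_mem x s (hBS h1)).resolve_right hs

variable {P : Set H} {p : H}

/-- Locally at a prime with principal maximal ideal, an invertible radical ideal contains an
element of order at most one. -/
theorem exists_mem_order_le_one (hP : IsPrimeSIdeal P) (hPt : IsRIdeal tClosure P) (hp : p ∈ P)
    (hgen : ∀ x ∈ P, ∃ s ∉ P, p ∣ s * x) {B : Set H} (hB : IsRInvertible tClosure B)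
    (hrad : IsRadical B) :
    ∃ f ∈ B, ∃ k ≤ 1, ∃ t ∉ P, ∃ u ∉ P, t * f = p ^ k * u := by
  obtain ⟨x, hx, z, hz, s, hs, hzx⟩ := hB.exists_notMem hPt hP.one_notMem
  refine ⟨x, hx, ?_⟩
  by_cases hxP : x ∈ P
  swap
  · exact ⟨0, zero_le_one, 1, hP.one_notMem, x, hxP, by simp⟩
  obtain ⟨t, ht, c, hc⟩ := hgen x hxP
  refine ⟨1, le_rfl, t, ht, c, fun hcP => ?_, by rw [pow_one, hc]⟩
  -- Suppose p² divides x locally, t'tx = p(pd). Then (pd)² is a multiple of x, so pd ∈ B and z(pd)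
  -- ∈ H. Hence t'ts = z(t'tx) is a multiple of p, although it lies outside P.
  obtain ⟨t', ht', d, hd⟩ := hgen c hcP
  have h2 : t' * t * x = p * (p * d) := by
    rw [mul_assoc, hc, mul_left_comm, hd]
  have hpd : p * d ∈ B := isRadical_iff.1 hrad _ 2 two_pos
    (hB.1.mem_of_dvd hx ⟨t' * t * d, by
      rw [pow_two]
      calc p * d * (p * d) = p * (p * d) * d := by ac_rfl
        _ = x * (t' * t * d) := by rw [← h2]; ac_rfl⟩)
  obtain ⟨h, hh⟩ := hz _ hpd
  refine hP.mul_notMem (hP.mul_notMem ht' ht) hs (hP.mem_of_dvd hp ⟨h, toQuotient_injective ?_⟩)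
  rw [toQuotient_mul, ← hzx, mul_left_comm, ← toQuotient_mul, h2, toQuotient_mul,
    toQuotient_mul p h, hh]
  exact mul_left_comm _ _ _

variable (hprod : ∀ e : H, e ∉ zeroElems H → IsFiniteProductOfRadicals tClosure {y : H | e ∣ y})
include hprod

/-- If eH is a t-product of n radical ideals, each contains an element of order at most 1. Their
product is a multiple of e of order at most n. -/
theorem exists_not_pow_dvd (hP : IsPrimeSIdeal P) (hPt : IsRIdeal tClosure P) (hp : p ∈ P)
    (hp0 : p ∉ zeroElems H) (hgen : ∀ x ∈ P, ∃ s ∉ P, p ∣ s * x) {e : H}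
    (he : e ∉ zeroElems H) : ∃ n : ℕ, ∀ s ∉ P, ¬ p ^ n ∣ s * e := by
  obtain ⟨n, J, hJ, h⟩ := hprod e he
  choose f hf k hk t ht u hu htf using fun i => exists_mem_order_le_one hP hPt hp hgen
    (isRInvertible_factor he (fun i => (hJ i).1) h i) (hJ i).2
  refine ⟨n + 1, fun s hs hdvd => ?_⟩
  obtain ⟨c, hc⟩ := hdvd
  obtain ⟨r, hr⟩ := dvd_prod_of_forall_mem h hf
  have hT : ∏ i, t i ∉ P := (primeCompl P hP).prod_mem fun i _ => ht i
  have hU : ∏ i, u i ∉ P := (primeCompl P hP).prod_mem fun i _ => hu i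
  have key : p ^ (∑ i, k i) * (s * ∏ i, u i) = p ^ (n + 1) * (c * r * ∏ i, t i) := by
    calc p ^ (∑ i, k i) * (s * ∏ i, u i) = s * ∏ i, (p ^ k i * u i) := by
          rw [Finset.prod_mul_distrib, Finset.prod_pow_eq_pow_sum]
          ac_rfl
      _ = s * e * (r * ∏ i, t i) := by
          rw [← Finset.prod_congr rfl fun i _ => htf i, Finset.prod_mul_distrib, hr]
          ac_rfl
      _ = _ := by rw [hc]; ac_rfl
  have h1 := le_of_pow_mul_eq hP hp hp0 (hP.mul_notMem hs hU) key
  have h2 : ∑ i, k i ≤ n := by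
    simpa using Finset.sum_le_card_nsmul Finset.univ k 1 fun i _ => hk i
  omega

/-- It suffices that wB ⊆ B, for then w B B⁻¹ ⊆ H. If a = wb ∉ B, choose a prime P ⊇ B without a at
which B is locally P, generated by p. From a^n e = b^n (w^n e), all powers of p would divide e
locally. -/
theorem mem_integers_of_mul_mem {B : Set H} (hB : IsRInvertible tClosure B) (hrad : IsRadical B)
    {w : QuotientMonoid H} (hw : ∀ y ∈ B, w * toQuotient y ∈ integers H) {e : H}
    (he : e ∉ zeroElems H) (hwe : ∀ n : ℕ, w ^ n * toQuotient e ∈ integers H) :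
    w ∈ integers H := by
  have hwB : ∀ b ∈ B, ∀ a : H, toQuotient a = w * toQuotient b → a ∈ B := by
    intro b hb a hab
    by_contra haB
    obtain ⟨P, hP, hPt, haP, hBP, hloc⟩ := exists_prime_of_notMem_radical hB.1 hrad haB
    obtain ⟨p, hpB, s, hs, hps⟩ := hB.exists_locally_dvd hPt hP.one_notMem
    have hp0 : p ∉ zeroElems H := by
      have hb0 : b ∉ zeroElems H := by
        intro hb0
        refine haP (hP.mem_of_mem_zeroElems ?_)
        intro x
        refine toQuotient_injective ?_
        rw [toQuotient_mul, hab, mul_assoc, ← toQuotient_mul, hb0 x]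
      exact notMem_zeroElems_of_dvd (mul_notMem_zeroElems (hP.notMem_zeroElems hs) hb0) (hps b hb)
    obtain ⟨n, hn⟩ := exists_not_pow_dvd hprod hP hPt (hBP hpB) hp0 (fun x hx => by
      obtain ⟨t, ht, htx⟩ := hloc x hx
      refine ⟨s * t, hP.mul_notMem hs ht, ?_⟩
      rw [mul_assoc]
      exact hps _ htx) he
    obtain ⟨c, hc⟩ := hwe n
    have h1 : a ^ n * e = b ^ n * c := by
      refine toQuotient_injective ?_
      rw [toQuotient_mul, toQuotient_mul, hc, toQuotient_pow, toQuotient_pow, hab, mul_pow]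
      ac_rfl
    refine hn (s ^ n * a ^ n) (hP.mul_notMem (hP.pow_notMem hs n) (hP.pow_notMem haP n)) ?_
    rw [mul_assoc, h1, ← mul_assoc, ← mul_pow]
    exact (pow_dvd_pow_of_dvd (hps b hb) n).mul_right c
  refine mem_integers_of_one_mem_tClosure (isRInvertible_iff.1 hB).2 fun h hh => ?_
  obtain ⟨x, hx, z, hz, hzx⟩ := mem_inverseProduct.1 hh
  obtain ⟨a, ha⟩ := hw x hx
  rw [← hzx, mul_left_comm, ← ha]
  exact hz a (hwB x hx a ha)

/-- If every nonzero principal ideal is a product of radical ideals, then `H` is completely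
integrally closed. -/
theorem mem_integers_of_pow_mul_mem {z : QuotientMonoid H} {e : H} (he : e ∉ zeroElems H)
    (hz : ∀ n : ℕ, z ^ n * toQuotient e ∈ integers H) : z ∈ integers H := by
  obtain ⟨a, b, hb, hab⟩ := exists_mul_toQuotient_eq z
  obtain ⟨n, J, hJ, h⟩ := hprod b hb
  -- The factors of bH are stripped off z · ∏ J_i one at a time. Fixing elements f_j of the
  -- remaining factors, the previous lemma applies to w = z ∏ f_j.
  have key : ∀ T : Finset (Fin n), (∀ f : Fin n → H, (∀ i ∈ T, f i ∈ J i) →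
      z * toQuotient (∏ i ∈ T, f i) ∈ integers H) → z ∈ integers H := by
    intro T
    induction T using Finset.induction_on with
    | empty =>
      intro hT
      simpa [toQuotient_one] using hT (fun _ => 1) (by simp)
    | insert i T hi ih =>
      intro hT
      refine ih fun f hf => mem_integers_of_mul_mem hprod
        (isRInvertible_factor hb (fun i => (hJ i).1) h i) (hJ i).2 (fun y hy => ?_) he fun n => ?_
      · have := hT (fun j => if j = i then y else f j) fun j hj => by
          by_cases hji : j = i
          · subst hji
            simpa using hy
          · simpa [hji] using hf j (Finset.mem_of_mem_insert_of_ne hj hji)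
        rw [Finset.prod_insert hi, if_pos rfl, Finset.prod_congr rfl fun j hj =>
          if_neg (ne_of_mem_of_not_mem hj hi), toQuotient_mul] at this
        convert this using 1
        ac_rfl
      · rw [mul_pow, mul_right_comm, ← toQuotient_pow]
        exact mul_mem (hz n) (toQuotient_mem_integers _)
  refine key Finset.univ fun f hf => ?_
  rw [mul_toQuotient_mem_integers_iff hb hab]
  exact (dvd_prod_of_forall_mem h fun i => hf i (Finset.mem_univ i)).mul_left a

variable (hfc : IsFiniteConductor (tClosure (H := H)))
include hfc

/-- Let C = xH ∩ yH be t-generated by the finite set F. A fraction z carrying x⁻¹F and y⁻¹F into H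
maps C into itself, so all z^n xy lie in H and z ∈ H. Hence x⁻¹F ∪ y⁻¹F has t-closure H and contains
some h ∉ M; then y ∣ hx or x ∣ hy. -/
theorem exists_locally_dvd_or_dvd {M : Set H} (hM : IsRMaximal tClosure M) {x y : H}
    (hx : x ∉ zeroElems H) (hy : y ∉ zeroElems H) : ∃ s ∉ M, x ∣ s * y ∨ y ∣ s * x := by
  obtain ⟨F, hf, hFC, hC⟩ := isFiniteConductor_iff.1 hfc x y
  rw [tClosure_eq_vClosure hf] at hC
  have hinj : ∀ a : H, a ∉ zeroElems H → Function.Injective (a * ·) :=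
    fun a ha b c hbc => cancel_left ha hbc
  have h1 : (1 : H) ∈ tClosure ((x * ·) ⁻¹' F ∪ (y * ·) ⁻¹' F) := by
    refine vClosure_subset_tClosure ((hf.preimage (hinj x hx).injOn).union
      (hf.preimage (hinj y hy).injOn)) subset_rfl (mem_vClosure.2 fun z hz => ?_)
    rw [toQuotient_one, mul_one]
    have hdiv : ∀ a : H, a ∉ zeroElems H → (∀ c ∈ F, a ∣ c) → (∀ h, a * h ∈ F →
        z * toQuotient h ∈ integers H) → ∀ c ∈ vClosure F, ∃ k,
        toQuotient (a * k) = z * toQuotient c := by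
      intro a ha haF hza c hc
      obtain ⟨v, hv⟩ := exists_inverse_toQuotient ha
      obtain ⟨k, hk⟩ := mem_vClosure.1 hc (z * v) fun d hd => by
        obtain ⟨d, rfl⟩ := haF d hd
        rw [toQuotient_mul, mul_assoc, ← mul_assoc v, hv, one_mul]
        exact hza d hd
      refine ⟨k, ?_⟩
      rw [toQuotient_mul, hk]
      calc toQuotient a * (z * v * toQuotient c) = v * toQuotient a * (z * toQuotient c) := by
            ac_rfl
        _ = z * toQuotient c := by rw [hv, one_mul]
    have hstep : ∀ c ∈ {c | x ∣ c} ∩ {c | y ∣ c}, ∃ d ∈ {c | x ∣ c} ∩ {c | y ∣ c},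
        toQuotient d = z * toQuotient c := by
      intro c hc
      rw [hC] at hc
      obtain ⟨k, hk⟩ := hdiv x hx (fun c hc => (hFC hc).1) (fun h hh => hz h (Or.inl hh)) c hc
      obtain ⟨l, hl⟩ := hdiv y hy (fun c hc => (hFC hc).2) (fun h hh => hz h (Or.inr hh)) c hc
      exact ⟨x * k, ⟨dvd_mul_right x k, ⟨l, toQuotient_injective (hk.trans hl.symm)⟩⟩, hk⟩
    have hpow : ∀ n : ℕ, ∃ d ∈ {c | x ∣ c} ∩ {c | y ∣ c},
        toQuotient d = z ^ n * toQuotient (x * y) := by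
      intro n
      induction n with
      | zero => exact ⟨x * y, ⟨dvd_mul_right x y, dvd_mul_left y x⟩, by simp⟩
      | succ n ih =>
        obtain ⟨c, hc, hcn⟩ := ih
        obtain ⟨d, hd, hdc⟩ := hstep c hc
        exact ⟨d, hd, by rw [hdc, hcn, pow_succ']; ac_rfl⟩
    refine mem_integers_of_pow_mul_mem hprod (mul_notMem_zeroElems hx hy) fun n => ?_
    obtain ⟨d, -, hd⟩ := hpow n
    exact ⟨d, hd⟩
  by_contra! hcon
  refine hM.one_notMem (tClosure_subset hM.isRIdeal (Set.union_subset ?_ ?_) h1)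
  · intro h hh
    by_contra hhM
    exact (hcon h hhM).2 (by rw [mul_comm]; exact (hFC hh).2)
  · intro h hh
    by_contra hhM
    exact (hcon h hhM).1 (by rw [mul_comm]; exact (hFC hh).1)

theorem isUniformizer_of_locally_dvd {M : Set H} (hM : IsRMaximal tClosure M) {B : Set H}
    (hB : IsRIdeal tClosure B) (hrad : IsRadical B) (hBM : B ⊆ M) {p s : H} (hp : p ∈ B)
    (hp0 : p ∉ zeroElems H) (hs : s ∉ M) (hps : ∀ y ∈ B, p ∣ s * y) : IsUniformizer M p := by
  have hP := hM.isPrimeSIdeal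
  have hgen : ∀ m ∈ M, ∃ t ∉ M, p ∣ t * m := by
    intro m hm
    by_cases hm0 : m ∈ zeroElems H
    · exact ⟨1, hP.one_notMem, dvd_of_mem_zeroElems (mul_mem_zeroElems_left hm0 1) p⟩
    obtain ⟨t, ht, hdvd | ⟨r, hr⟩⟩ := exists_locally_dvd_or_dvd hprod hfc hM hp0 hm0
    · exact ⟨t, ht, hdvd⟩
    have hr0 : r ∉ zeroElems H := notMem_zeroElems_of_dvd
      (mul_notMem_zeroElems (hP.notMem_zeroElems ht) hp0) ⟨m, by rw [hr, mul_comm]⟩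
    -- Now tp = mr, and m is compared with r. If m divides r locally, then mq ∈ B by radicality, and
    -- cancelling p puts an element outside M into M. If r divides m locally, then (t'm)² is a
    -- multiple of p, so t'm ∈ B.
    obtain ⟨t', ht', ⟨q, hq⟩ | ⟨q, hq⟩⟩ := exists_locally_dvd_or_dvd hprod hfc hM hm0 hr0
    · have h1 : t' * t * p = m * (m * q) := by
        rw [mul_assoc, hr, mul_left_comm, hq]
      have hmq : m * q ∈ B := isRadical_iff.1 hrad _ 2 two_pos
        (hB.mem_of_dvd hp ⟨t' * t * q, by
          rw [pow_two]
          calc m * q * (m * q) = m * (m * q) * q := by ac_rfl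
            _ = p * (t' * t * q) := by rw [← h1]; ac_rfl⟩)
      obtain ⟨c, hc⟩ := hps _ hmq
      refine absurd (hP.mem_of_dvd hm ⟨c, cancel_left hp0 ?_⟩)
        (hP.mul_notMem hs (hP.mul_notMem ht' ht))
      calc p * (s * (t' * t)) = m * (s * (m * q)) := by
            rw [mul_left_comm, mul_comm p, h1]; ac_rfl
        _ = p * (m * c) := by rw [hc]; ac_rfl
    · refine ⟨s * t', hP.mul_notMem hs ht', ?_⟩
      rw [mul_assoc]
      refine hps _ (isRadical_iff.1 hrad _ 2 two_pos (hB.mem_of_dvd hp ⟨t * t' * q, ?_⟩))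
      calc (t' * m) ^ 2 = r * m * (t' * q) := by
            rw [pow_two]
            nth_rewrite 1 [hq]
            ac_rfl
        _ = p * (t * t' * q) := by rw [mul_comm r, ← hr]; ac_rfl
  exact ⟨hBM hp, hp0, hgen, fun e he =>
    exists_not_pow_dvd hprod hP hM.isRIdeal (hBM hp) hp0 hgen he⟩

/-- If x ∈ M, some factor J_i lies in M and its local generator p is a uniformizer. With tx = p^k u,
the element up lies in the radical; as the radical is contained in J_i, any z ∈ J_i⁻¹ also belongs
to its inverse. -/
theorem isRInvertible_radical_setOf_dvd {x : H} (hx : x ∉ zeroElems H) :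
    IsRInvertible tClosure (radical {y : H | x ∣ y}) := by
  obtain ⟨n, J, hJ, h⟩ := hprod x hx
  have hrad := radical_setOf_dvd_eq_iInter hJ h
  have hmem := mem_factor (fun i => (hJ i).1) h
  refine isRInvertible_of_forall_maximal (hrad ▸ isRIdeal_iInter fun i => (hJ i).1)
    fun M hM => ?_
  have hP := hM.isPrimeSIdeal
  by_cases hxM : x ∈ M
  swap
  · exact ⟨x, subset_radical _ (dvd_refl x), 1,
      fun y _ => by simpa using toQuotient_mem_integers y, x, hxM, one_mul _⟩
  obtain ⟨i, hi⟩ := exists_factor_subset hP h hxM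
  obtain ⟨p, hp, z, hz, s, hs, hzp⟩ :=
    (isRInvertible_factor hx (fun i => (hJ i).1) h i).exists_notMem hM.isRIdeal hM.one_notMem
  have hps : ∀ y ∈ J i, p ∣ s * y := fun y hy => inverse_mul_dvd (hz y hy) hzp
  have hp0 : p ∉ zeroElems H := notMem_zeroElems_of_dvd
    (mul_notMem_zeroElems (hP.notMem_zeroElems hs) hx) (hps x (hmem i))
  obtain ⟨k, t, ht, u, hu, htu⟩ := (isUniformizer_of_locally_dvd hprod hfc hM (hJ i).1 (hJ i).2 hi
    hp hp0 hs hps).exists_eq_pow_mul hP hx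
  have hk : k ≠ 0 := by
    rintro rfl
    rw [pow_zero, one_mul] at htu
    exact hu (htu ▸ hP.mul_mem_left hxM t)
  refine ⟨u * p, ⟨k, Nat.pos_of_ne_zero hk, ?_⟩, z, fun y hy => hz y ?_, u * s,
    hP.mul_notMem hu hs, ?_⟩
  · obtain ⟨l, rfl⟩ := Nat.exists_eq_succ_of_ne_zero hk
    refine (⟨t * u ^ l, ?_⟩ : x ∣ _)
    calc (u * p) ^ (l + 1) = p ^ (l + 1) * u * u ^ l := by rw [mul_pow, pow_succ u]; ac_rfl
      _ = x * (t * u ^ l) := by rw [← htu]; ac_rfl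
  · rw [hrad] at hy
    exact Set.mem_iInter.1 hy i
  · rw [toQuotient_mul, toQuotient_mul, mul_left_comm, hzp]

end PrincipalFactorization

/-! ### The degenerate case H = G: only z(H) and H are t-ideals. -/

section EqQuotient

variable {H : Type*} [CommMonoid H] [CancellativeOffZero H] (hG : EqQuotient H)
include hG

theorem tClosure_of_subset_zeroElems {X : Set H} (hX : X ⊆ zeroElems H) :
    tClosure X = zeroElems H := by
  ext x
  rw [mem_tClosure]
  constructor
  · rintro ⟨E, hE, -, hx⟩
    rwa [vClosure, if_pos hG, if_pos (hE.trans hX)] at hx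
  · intro hx
    refine ⟨∅, Set.empty_subset _, Set.finite_empty, ?_⟩
    rwa [vClosure, if_pos hG, if_pos (Set.empty_subset _)]

theorem tClosure_of_notMem {X : Set H} {a : H} (ha : a ∈ X) (ha0 : a ∉ zeroElems H) :
    tClosure X = Set.univ := by
  refine Set.eq_univ_of_forall fun x => mem_tClosure.2 ⟨{a}, by simpa using ha,
    Set.finite_singleton a, ?_⟩
  rw [vClosure, if_pos hG, if_neg (by simpa using ha0)]
  exact Set.mem_univ x

theorem isRIdeal_iff_of_eqQuotient {X : Set H} :
    IsRIdeal tClosure X ↔ X = zeroElems H ∨ X = Set.univ := by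
  constructor
  · intro hX
    by_cases h : X ⊆ zeroElems H
    · exact Or.inl (hX.symm.trans (tClosure_of_subset_zeroElems hG h))
    · obtain ⟨a, ha, ha0⟩ := Set.not_subset.1 h
      exact Or.inr (hX.symm.trans (tClosure_of_notMem hG ha ha0))
  · rintro (rfl | rfl)
    · exact tClosure_of_subset_zeroElems hG subset_rfl
    · exact tClosure_of_notMem hG (Set.mem_univ 1) one_notMem_zeroElems

theorem setOf_dvd_of_eqQuotient {c : H} (hc : c ∉ zeroElems H) : {x : H | c ∣ x} = Set.univ :=
  Set.eq_univ_of_forall fun _ => (eqQuotient_iff.1 hG c hc).dvd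

theorem isFiniteProductOfComparableRadicals_of_eqQuotient {I : Set H}
    (hI : IsRIdeal tClosure I) : IsFiniteProductOfComparableRadicals tClosure I := by
  refine ⟨1, fun _ => I, fun _ => ⟨hI, ?_⟩, fun _ _ => Or.inl subset_rfl,
    by simpa using hI.symm⟩
  obtain rfl | rfl := (isRIdeal_iff_of_eqQuotient hG).1 hI
  · exact isRadical_zeroElems
  · exact isRadical_iff.2 fun x _ _ _ => Set.mem_univ x

theorem isRIdeal_isPrincipal_of_eqQuotient {I : Set H} (hI : IsPrincipal I) :
    IsRIdeal tClosure I := by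
  refine (isRIdeal_iff_of_eqQuotient hG).2 ?_
  obtain rfl | ⟨c, rfl⟩ := hI.eq_or
  · exact Or.inl rfl
  · by_cases hc : c ∈ zeroElems H
    · exact Or.inl (setOf_dvd_of_mem_zeroElems hc)
    · exact Or.inr (setOf_dvd_of_eqQuotient hG hc)

theorem isFiniteConductor_of_eqQuotient : IsFiniteConductor (tClosure (H := H)) := by
  rw [isFiniteConductor_iff]
  intro x y
  have hzero : ∀ C : Set H, zeroElems H ⊆ C → C ⊆ zeroElems H → IsRFinitelyGenerated tClosure C :=
    fun C h1 h2 => ⟨∅, Set.finite_empty, Set.empty_subset _, by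
      rw [tClosure_of_subset_zeroElems hG (Set.empty_subset _), h2.antisymm h1]⟩
  have hle : zeroElems H ⊆ {c | x ∣ c} ∩ {c | y ∣ c} := fun z hz =>
    ⟨dvd_of_mem_zeroElems hz x, dvd_of_mem_zeroElems hz y⟩
  by_cases hx : x ∈ zeroElems H
  · exact hzero _ hle (Set.inter_subset_left.trans (setOf_dvd_of_mem_zeroElems hx).subset)
  by_cases hy : y ∈ zeroElems H
  · exact hzero _ hle (Set.inter_subset_right.trans (setOf_dvd_of_mem_zeroElems hy).subset)
  rw [setOf_dvd_of_eqQuotient hG hx, setOf_dvd_of_eqQuotient hG hy, Set.inter_univ]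
  exact ⟨{1}, Set.finite_singleton 1, Set.subset_univ _,
    (tClosure_of_notMem hG (Set.mem_singleton 1) one_notMem_zeroElems).symm⟩

theorem isRInvertible_univ_of_eqQuotient : IsRInvertible tClosure (Set.univ : Set H) := by
  refine ⟨tClosure_of_notMem hG (Set.mem_univ 1) one_notMem_zeroElems,
    tClosure_of_notMem hG (a := 1) ?_ one_notMem_zeroElems⟩
  exact mem_inverseProduct.2 ⟨1, Set.mem_univ 1, 1,
    fun y _ => by simpa using toQuotient_mem_integers y, one_mul _⟩

end EqQuotient

theorem IsFiniteProductOfComparableRadicals.isFiniteProductOfRadicals {H : Type*} [CommMonoid H]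
    {r : Set H → Set H} {I : Set H} (h : IsFiniteProductOfComparableRadicals r I) :
    IsFiniteProductOfRadicals r I := by
  obtain ⟨n, J, hJ, -, hI⟩ := h
  exact ⟨n, J, hJ, hI⟩

theorem forall_nontrivial_isPrincipal_iff {H : Type*} [CommMonoid H] [CancellativeOffZero H]
    {p : Set H → Prop} : (∀ I : Set H, IsPrincipal I → zeroElems H ⊂ I → p I) ↔
      ∀ x : H, x ∉ zeroElems H → p {y : H | x ∣ y} := by
  constructor
  · intro h x hx
    exact h _ (isPrincipal_dvd x) ⟨fun z hz => dvd_of_mem_zeroElems hz x, fun h => hx (h dvd_rfl)⟩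
  · intro h I hI hlt
    obtain rfl | ⟨c, rfl⟩ := hI.eq_or
    · exact (hlt.ne rfl).elim
    · exact h c fun hc => hlt.ne (setOf_dvd_of_mem_zeroElems hc).symm

end IdealSystem

/-! ### The equivalence of the four conditions. -/

open IdealSystem in
theorem theorem4p2 (H : Type*) [CommMonoid H] [IdealSystem.CancellativeOffZero H] :
    List.TFAE [
      IdealSystem.IsAlmostDedekind (IdealSystem.tClosure (H := H)) ∧
        IdealSystem.IsSPMonoid (IdealSystem.tClosure (H := H)),
      IdealSystem.IsFiniteConductor (IdealSystem.tClosure (H := H)) ∧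
        ∀ I : Set H, IdealSystem.IsPrincipal I →
          IdealSystem.IsFiniteProductOfRadicals IdealSystem.tClosure I,
      ∀ I : Set H, IdealSystem.IsRIdeal IdealSystem.tClosure I →
        IdealSystem.IsFiniteProductOfComparableRadicals IdealSystem.tClosure I,
      ∀ I : Set H, IdealSystem.IsPrincipal I → IdealSystem.zeroElems H ⊂ I →
        IdealSystem.IsRInvertible IdealSystem.tClosure (IdealSystem.radical I)] := by
  rw [forall_nontrivial_isPrincipal_iff (p := fun I => IsRInvertible tClosure (radical I))]
  by_cases hG : EqQuotient H
  · have h3 := fun I => isFiniteProductOfComparableRadicals_of_eqQuotient hG (I := I)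
    have h1 : IsAlmostDedekind (tClosure (H := H)) ∧ IsSPMonoid (tClosure (H := H)) :=
      ⟨Or.inl hG, fun I hI => (h3 I hI).isFiniteProductOfRadicals⟩
    have h2 : IsFiniteConductor (tClosure (H := H)) ∧
        ∀ I : Set H, IsPrincipal I → IsFiniteProductOfRadicals tClosure I :=
      ⟨isFiniteConductor_of_eqQuotient hG, fun I hI =>
        h1.2 I (isRIdeal_isPrincipal_of_eqQuotient hG hI)⟩
    have h4 : ∀ x : H, x ∉ zeroElems H → IsRInvertible tClosure (radical {y : H | x ∣ y}) := by
      intro x hx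
      rw [setOf_dvd_of_eqQuotient hG hx,
        show radical (Set.univ : Set H) = Set.univ from
          Set.univ_subset_iff.1 (subset_radical _)]
      exact isRInvertible_univ_of_eqQuotient hG
    tfae_have 1 ↔ 2 := iff_of_true h1 h2
    tfae_have 2 ↔ 3 := iff_of_true h2 h3
    tfae_have 3 ↔ 4 := iff_of_true h3 h4
    tfae_finish
  have := Fact.mk hG
  tfae_have 1 → 2 := by
    rintro ⟨hAD, hSP⟩
    refine ⟨isFiniteConductor_of_locally_total fun M hM x y => ?_,
      fun I hI => hSP I hI.isRIdeal⟩
    obtain ⟨hP, hDVM⟩ := hAD.resolve_left hG M hM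
    obtain ⟨p, hp⟩ := exists_isUniformizer_of_isDVM hDVM
    obtain ⟨v, hv⟩ := hp.exists_isLocalValuation hP
    rcases le_total (v x) (v y) with h | h
    · obtain ⟨s, hs, hdvd⟩ := hv.exists_dvd_of_le x y h
      exact ⟨s, hs, Or.inl hdvd⟩
    · obtain ⟨s, hs, hdvd⟩ := hv.exists_dvd_of_le y x h
      exact ⟨s, hs, Or.inr hdvd⟩
  tfae_have 2 → 4 := fun ⟨hfc, hprod⟩ x hx =>
    isRInvertible_radical_setOf_dvd (fun e _ => hprod _ (isPrincipal_dvd e)) hfc hx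
  have hval (h4 : ∀ x : H, x ∉ zeroElems H →
      IsRInvertible tClosure (radical {y : H | x ∣ y})) :
      ∃ v : Set H → H → ℕ∞, ∀ M, IsRMaximal tClosure M → IsLocalValuation M (v M) := by
    have (M : Set H) (hM : IsRMaximal tClosure M) : ∃ v, IsLocalValuation M v := by
      obtain ⟨p, hp⟩ := exists_isUniformizer h4 hM
      exact hp.exists_isLocalValuation hM.isPrimeSIdeal
    choose! v hv using this
    exact ⟨v, hv⟩
  tfae_have 4 → 3 := by
    intro h4 I hI
    obtain ⟨v, hv⟩ := hval h4
    exact isFiniteProductOfComparableRadicals h4 hv hI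
  tfae_have 3 → 4 := by
    intro h3 x hx
    obtain ⟨n, J, hJ, hc, h⟩ := h3 _ (isRIdeal_setOf_dvd x)
    exact isRInvertible_radical_of_comparable hx hJ hc h
  tfae_have 4 → 1 := by
    intro h4
    obtain ⟨v, hv⟩ := hval h4
    exact ⟨Or.inr fun M hM => ⟨hM.isPrimeSIdeal, (hv M hM).isDVM⟩, fun I hI =>
      (isFiniteProductOfComparableRadicals h4 hv hI).isFiniteProductOfRadicals⟩
  tfae_finish
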